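/- Let $(\Omega,\mathscr F,\mathbb P)$ be a complete probability space and $(T,\Sigma,\mu)$ a complete finite (positive) measure space. Write $T=T_0\cup T_1$, where $T_1$ is the disjoint union of an at most countable family $\mathscr A$ of $\mu$-atoms (the large agents) and $T_0=T\setminus T_1$ contains no $\mu$-atom. For $x,y\in\mathbb R^\ell$ write $x\le y$ for the coordinatewise order, $x<y$ if $x\le y$ and $x\neq y$, and $x\gg 0$ if all coordinates of $x$ are positive. An economy $\mathscr E$ assigns to each agent $t\in T$ a partition $\Pi_t$ of $\Omega$ into sets of $\mathscr F$, which generates the $\sigma$-algebra $\mathscr F_t$; a utility function $U(t,\cdot,\cdot):\Omega\times\mathbb R^\ell_+\to\mathbb R$; an initial endowment $a(t,\cdot):\Omega\to\mathbb R^\ell_+$; and a prior $\mathbb P_t$, a probability measure on $\mathscr F$. Assume: - (A$'_1$) $a$ is $\Sigma\otimes\mathscr F$-measurable and, for each $\omega\in\Omega$, $a(\cdot,\omega)$ is integrable and $a(\cdot,\omega)\gg 0$ $\mu$-a.e.; - (A$_2$) $U(\cdot,\cdot,x)$ is $\Sigma\otimes\mathscr F$-measurable for each $x\in\mathbb R^\ell_+$;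 - (A$_3$) $U(t,\omega,\cdot)$ is continuous and strictly increasing ($x<y$ implies $U(t,\omega,x)<U(t,\omega,y)$) for all $(t,\omega)$; - (A$'_4$) $U(t,\omega,\cdot)$ is quasi-concave for all $(t,\omega)\in T_1\times\Omega$; - (A$_5$) there are finitely many partitions $\mathscr Q_1,\dots,\mathscr Q_n$ of $\Omega$ such that every $\Pi_t$ is one of them, each set $T^i=\{t\in T:\Pi_t=\mathscr Q_i\}$ is in $\Sigma$ with $\mu(T^i)>0$, and the $\sigma$-algebra generated by the common refinement of $\mathscr Q_1,\dots,\mathscr Q_n$ is $\mathscr F$; - (A$_6$) all agents $t\in T_1$ have the same characteristics $(\Pi_t,U(t,\cdot,\cdot),a(t,\cdot),\mathbb P_t)$. A coalition is a set $S\in\Sigma$ with $\mu(S)>0$. An assignment is a function $f:T\times\Omega\to\mathbb R^\ell_+$ such that $f(\cdot,\omega)$ is $\mu$-integrable for every $\omega$ and $f(t,\cdot)$ is $\mathscr F$-measurable for every $t$; it is an allocation if $\int_T f(\cdot,\omega)\,d\mu=\int_T a(\cdot,\omega)\,d\mu$ for every $\omega$. An allocation $f$ is ex-post blocked by a coalition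 $S$ if there are $\omega_0\in\Omega$ and an assignment $g$ with $\int_S g(\cdot,\omega_0)\,d\mu=\int_S a(\cdot,\omega_0)\,d\mu$ and $U(t,\omega_0,g(t,\omega_0))>U(t,\omega_0,f(t,\omega_0))$ for $\mu$-a.e. $t\in S$. The ex-post core ${\bf C}(\mathscr E)$ is the set of all allocations that are not ex-post blocked by any coalition. For a coalition $S$ let $\mathfrak P(S)=\{i:\mu(S\cap T^i)>0\}$, and let $\bigvee\{\mathscr Q_i:i\in\mathfrak P(S)\}$ be the $\sigma$-algebra generated by the common refinement of the $\mathscr Q_i$ with $i\in\mathfrak P(S)$. A communication system for $S$ is a family $\{\mathscr G_t:t\in S\}$ of sub-$\sigma$-algebras of $\mathscr F$ such that $\{t\in S:\mathscr G_t=\mathscr G\}\in\Sigma$ for every sub-$\sigma$-algebra $\mathscr G$ of $\mathscr F$, and $\mathscr F_t\subseteq\mathscr G_t\subseteq\bigvee\{\mathscr Q_i:i\in\mathfrak P(S)\}$ for $\mu$-a.e. $t\in S$. An allocation $f$ is fine blocked by a coalition $S$ if there are an allocation $g$, a communication system $\{\mathscr G_t:t\in S\}$ for $S$ and a nonempty $\Omega_0\in\bigcap_{t\in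 S}\mathscr G_t$ such that for all $\omega\in\Omega_0$ $$\int_S g(\cdot,\omega)\,d\mu=\int_S a(\cdot,\omega)\,d\mu\quad\text{and}\quad \mathbb E_t[U(t,\cdot,g(t,\cdot))\mid\mathscr G_t](\omega)>\mathbb E_t[U(t,\cdot,f(t,\cdot))\mid\mathscr G_t](\omega)\ \text{ for } \mu\text{-a.e. } t\in S,$$ where $\mathbb E_t[\,\cdot\mid\mathscr G_t]$ is the conditional expectation under $\mathbb P_t$. Here $\mathbb E_t[u\mid\mathscr G_t]=u$ (everywhere) if $u$ is $\mathscr G_t$-measurable; otherwise $u$ has to be $\mathbb P_t$-integrable, and the inequality is required for every choice of versions. The fine core ${\bf C}^{fine}(\mathscr E)$ is the set of all allocations that are not fine blocked by any coalition. If $|\mathscr A|\ge 2$ or $\mathscr A=\emptyset$, then ${\bf C}^{fine}(\mathscr E)\subseteq{\bf C}(\mathscr E)$. -/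

import Mathlib

open MeasureTheory Set

noncomputable section

namespace MixedEconomy

/-- A measurable set of positive measure that cannot be split into two measurable pieces of
positive measure. -/
def IsMeasureAtom {T : Type*} [MeasurableSpace T] (μ : Measure T) (A : Set T) : Prop :=
  MeasurableSet A ∧ 0 < μ A ∧
    ∀ B : Set T, MeasurableSet B → B ⊆ A → μ B = 0 ∨ μ (A \ B) = 0

/-- A decomposition `T = T₀ ∪ T₁` of the space of agents: `T₁` is the disjoint union of a
countable family of atoms, and `T₀`, the complement of `T₁`, contains no atom. -/
structure AtomDecomposition {T : Type*} [MeasurableSpace T] (μ : Measure T) where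
  /-- The family of large agents. -/
  atoms : Set (Set T)
  countable : atoms.Countable
  isAtom : ∀ A ∈ atoms, IsMeasureAtom μ A
  disjoint : atoms.PairwiseDisjoint id
  atomless : ∀ B ⊆ (⋃₀ atoms)ᶜ, ¬ IsMeasureAtom μ B

/-- The part `T₁` of the large agents. -/
def AtomDecomposition.large {T : Type*} [MeasurableSpace T] {μ : Measure T}
    (D : AtomDecomposition μ) : Set T :=
  ⋃₀ D.atoms

/-- The σ-algebra generated by a partition. Partitions of `Ω` are represented by the equivalence
relations whose classes are their blocks, so that the common refinement of a family of partitions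
is the infimum of the equivalence relations. -/
@[reducible]
def infoAlgebra {Ω : Type*} (r : Setoid Ω) : MeasurableSpace Ω :=
  MeasurableSpace.generateFrom r.classes

/-- `v` is a version of the conditional expectation of `u` given `G` under the prior `P`. If `u` is
`G`-measurable, its conditional expectation is `u` itself, at every state; otherwise `u` has to be
integrable and all versions are admitted. -/
def IsCondExp {Ω : Type*} (G : MeasurableSpace Ω) {mΩ : MeasurableSpace Ω} (P : Measure Ω)
    (u v : Ω → ℝ) : Prop :=
  (Measurable[G] u ∧ v = u) ∨
    (¬ Measurable[G] u ∧ Integrable u P ∧ Measurable[G] v ∧ v =ᵐ[P] P[u | G])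

/-- `E_P[u | G](ω) < E_P[w | G](ω)`: both conditional expectations exist, and the inequality holds
whichever versions are taken. -/
def CondExpLT {Ω : Type*} (G : MeasurableSpace Ω) {mΩ : MeasurableSpace Ω} (P : Measure Ω)
    (u w : Ω → ℝ) (ω : Ω) : Prop :=
  (∃ v, IsCondExp G P u v) ∧ (∃ v, IsCondExp G P w v) ∧
    ∀ v v', IsCondExp G P u v → IsCondExp G P w v' → v ω < v' ω

/-- A pure exchange economy with asymmetric information. The σ-algebras of events and of
measurable sets of agents are the ambient measurable structures of `Ω` and `T`. Only the values
of `U t ω` on the consumption set `{x | 0 ≤ x}` matter. -/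
structure Economy (Ω T : Type*) [MeasurableSpace Ω] [MeasurableSpace T] (ℓ : ℕ) where
  /-- The probability measure on the states of nature. -/
  prob : Measure Ω
  prob_isProbability : IsProbabilityMeasure prob
  prob_complete : prob.IsComplete
  /-- The measure on the space of agents. -/
  μ : Measure T
  μ_finite : IsFiniteMeasure μ
  μ_complete : μ.IsComplete
  /-- The information partition of each agent. -/
  part : T → Setoid Ω
  measurableSet_part : ∀ t, ∀ B ∈ (part t).classes, MeasurableSet B
  /-- The state-dependent utility functions. -/
  U : T → Ω → (Fin ℓ → ℝ) → ℝ
  /-- The state-dependent initial endowments. -/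
  a : T → Ω → Fin ℓ → ℝ
  a_nonneg : ∀ t ω, 0 ≤ a t ω
  /-- The prior beliefs. -/
  prior : T → Measure Ω
  prior_isProbability : ∀ t, IsProbabilityMeasure (prior t)

namespace Economy

variable {Ω T : Type*} [mΩ : MeasurableSpace Ω] [MeasurableSpace T] {ℓ : ℕ}

/-- Two agents are of the same type: they have the same information, utility function, initial
endowment and prior. -/
def SameType (E : Economy Ω T ℓ) (t s : T) : Prop :=
  E.part t = E.part s ∧
    (∀ ω, ∀ x, 0 ≤ x → E.U t ω x = E.U s ω x) ∧
    E.a t = E.a s ∧ E.prior t = E.prior s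

/-- The endowment is jointly measurable, integrable over the agents in every state, and in every
state strictly positive in all commodities for almost every agent. -/
def A1' (E : Economy Ω T ℓ) : Prop :=
  Measurable (fun p : T × Ω => E.a p.1 p.2) ∧
    (∀ ω, Integrable (fun t => E.a t ω) E.μ) ∧
    ∀ ω, ∀ᵐ t ∂E.μ, ∀ h, 0 < E.a t ω h

/-- Joint measurability of the utility in agent and state. -/
def A2 (E : Economy Ω T ℓ) : Prop :=
  ∀ x, 0 ≤ x → Measurable (fun p : T × Ω => E.U p.1 p.2 x)

/-- The utilities are continuous and strictly increasing in consumption. -/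
def A3 (E : Economy Ω T ℓ) : Prop :=
  ∀ t ω, ContinuousOn (E.U t ω) (Ici 0) ∧ StrictMonoOn (E.U t ω) (Ici 0)

/-- The utilities of the large agents are quasi-concave. -/
def A4' (E : Economy Ω T ℓ) (D : AtomDecomposition E.μ) : Prop :=
  ∀ t ∈ D.large, ∀ ω, QuasiconcaveOn ℝ (Ici 0) (E.U t ω)

/-- Every agent has one of the partitions `Q 1, …, Q n`, each of them is held by a (measurable)
set of agents of positive measure, and jointly the agents have all the information. -/
def A5 (E : Economy Ω T ℓ) {n : ℕ} (Q : Fin n → Setoid Ω) : Prop :=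
  (∀ i, MeasurableSet {t | E.part t = Q i} ∧ 0 < E.μ {t | E.part t = Q i}) ∧
    (∀ t, ∃ i, E.part t = Q i) ∧
    infoAlgebra (⨅ i, Q i) = mΩ

/-- All large agents are of the same type. -/
def A6 (E : Economy Ω T ℓ) (D : AtomDecomposition E.μ) : Prop :=
  ∀ t ∈ D.large, ∀ s ∈ D.large, E.SameType t s

/-- A coalition: a measurable set of agents of positive measure. -/
def IsCoalition (E : Economy Ω T ℓ) (S : Set T) : Prop :=
  MeasurableSet S ∧ 0 < E.μ S

/-- An assignment: a map into the consumption set that is integrable over the agents in every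
state and measurable in the state for every agent. -/
def IsAssignment (E : Economy Ω T ℓ) (f : T → Ω → Fin ℓ → ℝ) : Prop :=
  (∀ t ω, 0 ≤ f t ω) ∧ (∀ ω, Integrable (fun t => f t ω) E.μ) ∧ ∀ t, Measurable (f t)

/-- An allocation: a feasible assignment. -/
def IsAllocation (E : Economy Ω T ℓ) (f : T → Ω → Fin ℓ → ℝ) : Prop :=
  E.IsAssignment f ∧ ∀ ω, ∫ t, f t ω ∂E.μ = ∫ t, E.a t ω ∂E.μ

/-- `f` is ex-post blocked by the coalition `S`. -/
def ExPostBlocked (E : Economy Ω T ℓ) (f : T → Ω → Fin ℓ → ℝ) (S : Set T) : Prop :=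
  ∃ (ω₀ : Ω) (g : T → Ω → Fin ℓ → ℝ), E.IsAssignment g ∧
    ∫ t in S, g t ω₀ ∂E.μ = ∫ t in S, E.a t ω₀ ∂E.μ ∧
    ∀ᵐ t ∂E.μ.restrict S, E.U t ω₀ (f t ω₀) < E.U t ω₀ (g t ω₀)

/-- The ex-post core. -/
def exPostCore (E : Economy Ω T ℓ) : Set (T → Ω → Fin ℓ → ℝ) :=
  {f | E.IsAllocation f ∧ ∀ S, E.IsCoalition S → ¬ E.ExPostBlocked f S}

/-- The indices of the partitions that are held by a non-negligible part of `S`. -/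
def partIndices (E : Economy Ω T ℓ) {n : ℕ} (Q : Fin n → Setoid Ω) (S : Set T) : Set (Fin n) :=
  {i | 0 < E.μ {t ∈ S | E.part t = Q i}}

/-- The pooled information of `S`: the σ-algebra generated by the common refinement of the
partitions that are held by a non-negligible part of `S`. -/
@[reducible]
def pooledInfo (E : Economy Ω T ℓ) {n : ℕ} (Q : Fin n → Setoid Ω) (S : Set T) :
    MeasurableSpace Ω :=
  infoAlgebra (⨅ i ∈ E.partIndices Q S, Q i)

/-- An information structure for `S` (only the values `𝒢 t` with `t ∈ S` matter). -/
def IsInformationStructure (_E : Economy Ω T ℓ) (S : Set T) (𝒢 : T → MeasurableSpace Ω) : Prop :=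
  (∀ t ∈ S, 𝒢 t ≤ mΩ) ∧
    ∀ G : MeasurableSpace Ω, G ≤ mΩ →
      MeasurableSet {t ∈ S | 𝒢 t = G}

/-- A communication system for `S`. -/
def IsCommunicationSystem (E : Economy Ω T ℓ) {n : ℕ} (Q : Fin n → Setoid Ω) (S : Set T)
    (𝒢 : T → MeasurableSpace Ω) : Prop :=
  E.IsInformationStructure S 𝒢 ∧
    ∀ᵐ t ∂E.μ.restrict S, infoAlgebra (E.part t) ≤ 𝒢 t ∧ 𝒢 t ≤ E.pooledInfo Q S

/-- `f` is fine blocked by the coalition `S`. -/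
def FineBlocked (E : Economy Ω T ℓ) {n : ℕ} (Q : Fin n → Setoid Ω) (f : T → Ω → Fin ℓ → ℝ)
    (S : Set T) : Prop :=
  ∃ (g : T → Ω → Fin ℓ → ℝ) (𝒢 : T → MeasurableSpace Ω) (Ω₀ : Set Ω),
    E.IsAllocation g ∧ E.IsCommunicationSystem Q S 𝒢 ∧
    Ω₀.Nonempty ∧ (∀ t ∈ S, MeasurableSet[𝒢 t] Ω₀) ∧
    ∀ ω ∈ Ω₀,
      ∫ t in S, g t ω ∂E.μ = ∫ t in S, E.a t ω ∂E.μ ∧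
      ∀ᵐ t ∂E.μ.restrict S,
        CondExpLT (𝒢 t) (E.prior t) (fun ω' => E.U t ω' (f t ω')) (fun ω' => E.U t ω' (g t ω')) ω

/-- The fine core. -/
def fineCore (E : Economy Ω T ℓ) {n : ℕ} (Q : Fin n → Setoid Ω) : Set (T → Ω → Fin ℓ → ℝ) :=
  {f | E.IsAllocation f ∧ ∀ S, E.IsCoalition S → ¬ E.FineBlocked Q f S}

end Economy

end MixedEconomy

end

/-! Suppose `f` is ex-post blocked at `ω₀`. It suffices to find a blocking coalition `S'` in the
complete-information market at `ω₀` that meets every `T^i` in positive measure. Such an `S'` pools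
all of `mΩ`, and every measurable function is constant on the block `Ω₀` of the common refinement
containing `ω₀`. Conditional expectations given `mΩ` are then the utilities themselves, and
improvement at `ω₀` is improvement on all of `Ω₀`: `f` is fine blocked (`fineBlocked_of_blocks`).

The coalition `S'` comes from `Blocks.exists_meeting`. Small agents may take part fractionally: an
approximate Lyapunov theorem realizes fractions by actual sets, provided the fractional coalition
has a strict surplus of every commodity to absorb the error (`exists_blocks_of_fractional`). Such
surpluses are created by shaving strictly improving bundles (`exists_improvement_integral_lt`).
Without atoms, half of `S` joined with half of everybody (who keep `x`) works.

With atoms, let `z` be the average bundle of the large agents, who share a utility `W`, and let `M`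
be their mass. If some of them are worse off than at `z`, then so is almost all of some atom `A`,
and `A` blocks with a fraction `μ(A)/M` of the small agents. Otherwise quasi-concavity makes them
all indifferent to `z`. Then a weighted sum of `S` and the grand coalition is scaled until its large
part has the mass of a single atom, which replaces that part and consumes its average bundle.
Positive weight on `S` requires the atom to be smaller than the whole large part, hence a second
atom. All large agents have the same partition, so one atom represents them in every `T^i`. -/

noncomputable section

namespace MixedEconomy

/-! ### Atomless measures: intermediate values and approximate Lyapunov. -/

section Atomless

variable {T : Type*} [MeasurableSpace T] {μ : Measure T} [IsFiniteMeasure μ]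

theorem exists_subset_measureReal_le_half {P : Set T} (hP : MeasurableSet P)
    (hat : ¬ IsMeasureAtom μ P) (hpos : 0 < μ.real P) :
    ∃ D ⊆ P, MeasurableSet D ∧ 0 < μ.real D ∧ μ.real D ≤ μ.real P / 2 := by
  have hμP : 0 < μ P := by
    rw [pos_iff_ne_zero]
    intro h
    simp [measureReal_def, h] at hpos
  simp only [IsMeasureAtom, hP, hμP, true_and, not_forall, not_or] at hat
  obtain ⟨B, hB, hBP, h1, h2⟩ := hat
  have hB0 : 0 < μ.real B := ENNReal.toReal_pos h1 (measure_ne_top _ _)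
  have hC0 : 0 < μ.real (P \ B) := ENNReal.toReal_pos h2 (measure_ne_top _ _)
  have hsum : μ.real (P \ B) = μ.real P - μ.real B := measureReal_sdiff hBP hB
  rcases le_total (μ.real B) (μ.real P / 2) with h | h
  · exact ⟨B, hBP, hB, hB0, h⟩
  · exact ⟨P \ B, sdiff_subset, hP.diff hB, hC0, by linarith⟩

theorem exists_subset_measureReal_lt {P : Set T} (hP : MeasurableSet P)
    (hat : ∀ B ⊆ P, ¬ IsMeasureAtom μ B) (hpos : 0 < μ.real P) {δ : ℝ} (hδ : 0 < δ) :
    ∃ D ⊆ P, MeasurableSet D ∧ 0 < μ.real D ∧ μ.real D < δ := by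
  have key : ∀ k : ℕ, ∃ D ⊆ P, MeasurableSet D ∧ 0 < μ.real D ∧
      μ.real D ≤ μ.real P * (1 / 2) ^ k := by
    intro k
    induction k with
    | zero => exact ⟨P, subset_rfl, hP, hpos, by simp⟩
    | succ k ih =>
      obtain ⟨D, hDP, hD, hD0, hDk⟩ := ih
      obtain ⟨D', hD'D, hD', hD'0, hD'k⟩ := exists_subset_measureReal_le_half hD (hat D hDP) hD0
      refine ⟨D', hD'D.trans hDP, hD', hD'0, ?_⟩
      rw [pow_succ]
      linarith
  have hlim : Filter.Tendsto (fun k : ℕ => μ.real P * (1 / 2 : ℝ) ^ k) Filter.atTop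
      (nhds (μ.real P * 0)) :=
    (tendsto_pow_atTop_nhds_zero_of_lt_one (by norm_num) (by norm_num)).const_mul _
  rw [mul_zero] at hlim
  obtain ⟨k, hk⟩ := (hlim.eventually (gt_mem_nhds hδ)).exists
  obtain ⟨D, h1, h2, h3, h4⟩ := key k
  exact ⟨D, h1, h2, h3, h4.trans_lt hk⟩

/-- Sierpiński's theorem: a measure without atoms takes all intermediate values. -/
theorem exists_subset_measureReal_eq {P : Set T} (hP : MeasurableSet P)
    (hat : ∀ B ⊆ P, ¬ IsMeasureAtom μ B) {c : ℝ} (hc : 0 ≤ c) (hcP : c ≤ μ.real P) :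
    ∃ B ⊆ P, MeasurableSet B ∧ μ.real B = c := by
  let X := {B : Set T // MeasurableSet B ∧ B ⊆ P ∧ μ.real B ≤ c}
  -- Greedy exhaustion: add a piece at least half as large as the supremum of the pieces that still
  -- fit under `c`.
  have step : ∀ B : X, ∃ B' : X, B.1 ⊆ B'.1 ∧ ∀ D : Set T, MeasurableSet D → D ⊆ P \ B.1 →
      μ.real B.1 + μ.real D ≤ c → μ.real D ≤ 2 * (μ.real B'.1 - μ.real B.1) := by
    rintro ⟨B, hB, hBP, hBc⟩
    let V : Set ℝ := {r | ∃ D, MeasurableSet D ∧ D ⊆ P \ B ∧ μ.real B + μ.real D ≤ c ∧ μ.real D = r}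
    have hV0 : (0 : ℝ) ∈ V := ⟨∅, .empty, empty_subset _, by simpa using hBc, by simp⟩
    have hVb : BddAbove V := ⟨c, by
      rintro r ⟨D, -, -, h, rfl⟩
      have : 0 ≤ μ.real B := measureReal_nonneg
      linarith⟩
    have hs0 : 0 ≤ sSup V := le_csSup hVb hV0
    obtain ⟨r, ⟨D, hD, hDP, hDc, hDr⟩, hr⟩ : ∃ r ∈ V, sSup V ≤ 2 * r := by
      rcases hs0.eq_or_lt with h | h
      · exact ⟨0, hV0, by linarith⟩
      · obtain ⟨r, hr, hlt⟩ := exists_lt_of_lt_csSup ⟨0, hV0⟩ (half_lt_self h)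
        exact ⟨r, hr, by linarith⟩
    have hdisj : Disjoint B D := disjoint_sdiff_right.mono_right hDP
    have hun : μ.real (B ∪ D) = μ.real B + μ.real D := measureReal_union hdisj hD
    refine ⟨⟨B ∪ D, hB.union hD, union_subset hBP (hDP.trans sdiff_subset), by linarith⟩,
      subset_union_left, fun D' hD' hD'P hD'c => ?_⟩
    have : μ.real D' ≤ sSup V := le_csSup hVb ⟨D', hD', hD'P, hD'c, rfl⟩
    simp only [hun]
    linarith
  choose next hsub hnext using step
  let seq : ℕ → X := fun k => next^[k] ⟨∅, .empty, empty_subset _, by simpa using hc⟩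
  have hseq : ∀ k, seq (k + 1) = next (seq k) := fun k => Function.iterate_succ_apply' next k _
  have hmono : Monotone fun k => (seq k).1 := by
    refine monotone_nat_of_le_succ fun k => ?_
    rw [hseq]
    exact hsub _
  set B : Set T := ⋃ k, (seq k).1 with hBdef
  have hB : MeasurableSet B := .iUnion fun k => (seq k).2.1
  have hBP : B ⊆ P := iUnion_subset fun k => (seq k).2.2.1
  have hlim : Filter.Tendsto (fun k => μ.real (seq k).1) Filter.atTop (nhds (μ.real B)) :=
    (ENNReal.tendsto_toReal (measure_ne_top _ _)).comp (tendsto_measure_iUnion_atTop hmono)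
  have hBc : μ.real B ≤ c := le_of_tendsto' hlim fun k => (seq k).2.2.2
  refine ⟨B, hBP, hB, hBc.antisymm (not_lt.1 fun hlt => ?_)⟩
  have hdiff : μ.real (P \ B) = μ.real P - μ.real B := measureReal_sdiff hBP hB
  obtain ⟨D, hDP, hD, hD0, hDlt⟩ := exists_subset_measureReal_lt (hP.diff hB)
    (fun C hC => hat C (hC.trans sdiff_subset)) (by linarith) (sub_pos.2 hlt)
  -- `D` would fit at every stage, so each gain is at least half its measure; but the gains tend to
  -- zero.
  have hbound : ∀ k, μ.real D ≤ 2 * (μ.real (seq (k + 1)).1 - μ.real (seq k).1) := by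
    intro k
    rw [hseq]
    have hkB : (seq k).1 ⊆ B := subset_iUnion (fun k => (seq k).1) k
    refine hnext (seq k) D hD (hDP.trans (sdiff_subset_sdiff_right hkB)) ?_
    have : μ.real (seq k).1 ≤ μ.real B := measureReal_mono hkB
    linarith
  have hlim' : Filter.Tendsto (fun k => 2 * (μ.real (seq (k + 1)).1 - μ.real (seq k).1))
      Filter.atTop (nhds (2 * (μ.real B - μ.real B))) :=
    (((Filter.tendsto_add_atTop_iff_nat 1).2 hlim).sub hlim).const_mul 2
  have := ge_of_tendsto' hlim' hbound
  simp at this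
  linarith

/-- `B` takes the exact share `p` of each fibre of `s`, so for `s` the error vanishes; replacing `Φ`
by `s` costs less than `η / 2` on `B` and on `P`. -/
theorem norm_setIntegral_sub_smul_lt {μ : Measure T} {F : Type*} [NormedAddCommGroup F]
    [NormedSpace ℝ F] [CompleteSpace F] {P B : Set T} (hBP : B ⊆ P)
    {Φ : T → F} (hΦ : IntegrableOn Φ P μ) {s : SimpleFunc T F} (hs : IntegrableOn s P μ)
    {p η : ℝ} (hp : 0 ≤ p) (hp1 : p ≤ 1)
    (hfrac : ∀ c, μ.real (s ⁻¹' {c} ∩ B) = p * μ.real (s ⁻¹' {c} ∩ P))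
    (hη : ∫ t in P, ‖Φ t - s t‖ ∂μ < η / 2) :
    ‖∫ t in B, Φ t ∂μ - p • ∫ t in P, Φ t ∂μ‖ < η := by
  have hsB : IntegrableOn s B μ := hs.mono_set hBP
  have heq : ∫ t in B, s t ∂μ = p • ∫ t in P, s t ∂μ := by
    rw [← SimpleFunc.integral_eq_integral _ hs, ← SimpleFunc.integral_eq_integral _ hsB,
      SimpleFunc.integral_eq, SimpleFunc.integral_eq, Finset.smul_sum]
    refine Finset.sum_congr rfl fun c _ => ?_
    rw [measureReal_restrict_apply (s.measurableSet_fiber c),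
      measureReal_restrict_apply (s.measurableSet_fiber c), hfrac, mul_smul]
  have hd : IntegrableOn (fun t => Φ t - s t) P μ := hΦ.sub hs
  have h1 : ∫ t in B, (Φ t - s t) ∂μ = ∫ t in B, Φ t ∂μ - ∫ t in B, s t ∂μ :=
    integral_sub (hΦ.mono_set hBP) hsB
  have h2 : ∫ t in P, (Φ t - s t) ∂μ = ∫ t in P, Φ t ∂μ - ∫ t in P, s t ∂μ := integral_sub hΦ hs
  have h3 : ∫ t in B, Φ t ∂μ - p • ∫ t in P, Φ t ∂μ =
      ∫ t in B, (Φ t - s t) ∂μ - p • ∫ t in P, (Φ t - s t) ∂μ := by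
    rw [h1, h2, heq, smul_sub]
    abel
  have h4 : ‖∫ t in B, (Φ t - s t) ∂μ‖ ≤ ∫ t in P, ‖Φ t - s t‖ ∂μ :=
    (norm_integral_le_integral_norm _).trans
      (setIntegral_mono_set hd.norm (.of_forall fun _ => norm_nonneg _)
        (LE.le.eventuallyLE hBP))
  have h5 : ‖p • ∫ t in P, (Φ t - s t) ∂μ‖ ≤ ∫ t in P, ‖Φ t - s t‖ ∂μ := by
    rw [norm_smul, Real.norm_of_nonneg hp]
    exact (mul_le_of_le_one_left (norm_nonneg _) hp1).trans (norm_integral_le_integral_norm _)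
  rw [h3]
  exact (norm_sub_le _ _).trans_lt (by linarith)

/-- An approximate form of Lyapunov's theorem, for two disjoint sets at a time. -/
theorem exists_disjoint_subsets_norm_setIntegral_sub_lt {F : Type*} [NormedAddCommGroup F]
    [NormedSpace ℝ F] [CompleteSpace F] {P : Set T} (hP : MeasurableSet P)
    (hat : ∀ B ⊆ P, ¬ IsMeasureAtom μ B) {Φ : T → F} (hΦ : IntegrableOn Φ P μ) {p q η : ℝ}
    (hp : 0 ≤ p) (hq : 0 ≤ q) (hpq : p + q ≤ 1) (hη : 0 < η) :
    ∃ B ⊆ P, ∃ C ⊆ P, MeasurableSet B ∧ MeasurableSet C ∧ Disjoint B C ∧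
      ‖∫ t in B, Φ t ∂μ - p • ∫ t in P, Φ t ∂μ‖ < η ∧
      ‖∫ t in C, Φ t ∂μ - q • ∫ t in P, Φ t ∂μ‖ < η := by
  obtain ⟨s, hs, hsm⟩ := (memLp_one_iff_integrable.2 hΦ).exists_simpleFunc_eLpNorm_sub_lt
    ENNReal.one_ne_top (ε := ENNReal.ofReal (η / 2)) (by simpa using hη)
  have hsi : IntegrableOn s P μ := memLp_one_iff_integrable.1 hsm
  have hη' : ∫ t in P, ‖Φ t - s t‖ ∂μ < η / 2 := by
    have hd : Integrable (Φ - ⇑s) (μ.restrict P) := hΦ.sub hsi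
    have h : ∫ t in P, ‖Φ t - s t‖ ∂μ = (eLpNorm (Φ - ⇑s) 1 (μ.restrict P)).toReal := by
      rw [eLpNorm_one_eq_lintegral_enorm, ← integral_norm_eq_lintegral_enorm hd.1]
      rfl
    rw [h]
    exact (ENNReal.lt_ofReal_iff_toReal_lt (ne_top_of_lt hs)).1 hs
  have hsel : ∀ c : F, ∃ B ⊆ s ⁻¹' {c} ∩ P, ∃ C ⊆ s ⁻¹' {c} ∩ P, MeasurableSet B ∧
      MeasurableSet C ∧ Disjoint B C ∧ μ.real B = p * μ.real (s ⁻¹' {c} ∩ P) ∧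
      μ.real C = q * μ.real (s ⁻¹' {c} ∩ P) := by
    intro c
    have hPc : MeasurableSet (s ⁻¹' {c} ∩ P) := (s.measurableSet_fiber c).inter hP
    have h0 : 0 ≤ μ.real (s ⁻¹' {c} ∩ P) := measureReal_nonneg
    obtain ⟨B, hBP, hB, hBm⟩ := exists_subset_measureReal_eq hPc
      (fun B hB => hat B (hB.trans inter_subset_right)) (mul_nonneg hp h0)
      (mul_le_of_le_one_left h0 (by linarith))
    have hdiff := measureReal_sdiff (μ := μ) hBP hB
    obtain ⟨C, hCP, hC, hCm⟩ := exists_subset_measureReal_eq (hPc.diff hB)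
      (fun C hC => hat C (hC.trans (sdiff_subset.trans inter_subset_right))) (mul_nonneg hq h0)
      (by rw [hdiff, hBm]; nlinarith)
    exact ⟨B, hBP, C, hCP.trans sdiff_subset, hB, hC, disjoint_sdiff_right.mono_right hCP, hBm, hCm⟩
  choose B hBP C hCP hB hC hBC hBm hCm using hsel
  have hinter : ∀ D : F → Set T, (∀ c, D c ⊆ s ⁻¹' {c} ∩ P) → ∀ c,
      s ⁻¹' {c} ∩ ⋃ d ∈ s.range, D d = D c := by
    intro D hD c
    ext t
    simp only [mem_inter_iff, mem_preimage, mem_singleton_iff, mem_iUnion, exists_prop]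
    constructor
    · rintro ⟨h, d, -, htd⟩
      have : s t = d := (hD d htd).1
      rwa [← h, this]
    · intro h
      have : s t = c := (hD c h).1
      exact ⟨this, c, this ▸ s.mem_range_self t, h⟩
  have hBP' : ⋃ d ∈ s.range, B d ⊆ P := iUnion₂_subset fun d _ => (hBP d).trans inter_subset_right
  have hCP' : ⋃ d ∈ s.range, C d ⊆ P := iUnion₂_subset fun d _ => (hCP d).trans inter_subset_right
  have hB' : MeasurableSet (⋃ d ∈ s.range, B d) := Finset.measurableSet_biUnion _ fun d _ => hB d
  have hC' : MeasurableSet (⋃ d ∈ s.range, C d) := Finset.measurableSet_biUnion _ fun d _ => hC d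
  refine ⟨_, hBP', _, hCP', hB', hC', ?_, ?_, ?_⟩
  · simp only [disjoint_iUnion_left, disjoint_iUnion_right]
    intro d _ c _
    by_cases h : c = d
    · exact h ▸ hBC c
    · refine Set.disjoint_left.2 fun t ht ht' => h ?_
      have h1 : s t = _ := (hBP _ ht).1
      have h2 : s t = _ := (hCP _ ht').1
      exact h1.symm.trans h2
  · exact norm_setIntegral_sub_smul_lt hBP' hΦ hsi hp (by linarith)
      (fun c => by rw [hinter B hBP, hBm]) hη'
  · exact norm_setIntegral_sub_smul_lt hCP' hΦ hsi hq (by linarith)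
      (fun c => by rw [hinter C hCP, hCm]) hη'

end Atomless

/-! ### Monotone continuous utilities: shaving bundles and averaging. -/

section Utility

/-- A family of continuous and strictly increasing utility functions on the positive orthant,
depending measurably on the parameter. -/
structure IsUtility {T : Type*} [MeasurableSpace T] {ℓ : ℕ} (V : T → (Fin ℓ → ℝ) → ℝ) : Prop where
  measurable : ∀ x, 0 ≤ x → Measurable fun t => V t x
  continuousOn : ∀ t, ContinuousOn (V t) (Ici 0)
  strictMonoOn : ∀ t, StrictMonoOn (V t) (Ici 0)

variable {T : Type*} [MeasurableSpace T] {ℓ : ℕ} {V : T → (Fin ℓ → ℝ) → ℝ}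

theorem IsUtility.measurable_comp (hV : IsUtility V) {x : T → Fin ℓ → ℝ} (hx : Measurable x)
    (hx0 : ∀ t, 0 ≤ x t) : Measurable fun t => V t (x t) := by
  -- Composing with `y ⊔ 0` makes the utility continuous on the whole space, as the Carathéodory
  -- criterion needs.
  have h : Measurable (Function.uncurry fun (y : Fin ℓ → ℝ) (t : T) => V t (y ⊔ 0)) := by
    refine measurable_uncurry_of_continuous_of_measurable (fun t => ?_)
      fun y => hV.measurable _ le_sup_right
    exact (hV.continuousOn t).comp_continuous (continuous_pi fun i =>
      (continuous_apply i).max continuous_const) fun y => mem_Ici.2 le_sup_right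
  have h' := h.comp (hx.prodMk measurable_id)
  convert h' using 2 with t
  simp [sup_eq_left.2 (hx0 t)]

theorem IsUtility.const {W : (Fin ℓ → ℝ) → ℝ} (hc : ContinuousOn W (Ici 0))
    (hm : StrictMonoOn W (Ici 0)) : IsUtility fun _ : T => W :=
  ⟨fun _ _ => measurable_const, fun _ => hc, fun _ => hm⟩

/-- Strict improvements remain strict improvements if a little of each commodity is given up. -/
theorem IsUtility.exists_improvement_integral_lt (hV : IsUtility V) {ν : Measure T}
    {x g : T → Fin ℓ → ℝ} (hx : Measurable x) (hx0 : ∀ t, 0 ≤ x t) (hg : Measurable g)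
    (hg0 : ∀ t, 0 ≤ g t) (hgi : Integrable g ν) (hlt : ∀ᵐ t ∂ν, V t (x t) < V t (g t)) :
    ∃ g' : T → Fin ℓ → ℝ, Measurable g' ∧ (∀ t, 0 ≤ g' t) ∧ (∀ t, g' t ≤ g t) ∧
      (∀ᵐ t ∂ν, V t (x t) < V t (g' t)) ∧
      ∀ h, 0 < ∫ t, g t h ∂ν → ∫ t, g' t h ∂ν < ∫ t, g t h ∂ν := by
  set r : ℕ → ℝ := fun k => 1 / ((k : ℝ) + 1)
  have hr0 : ∀ k, 0 < r k := fun k => Nat.one_div_pos_of_nat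
  have hr1 : ∀ k, r k ≤ 1 := fun k => by
    simp only [r]
    rw [div_le_one (by positivity)]
    linarith [(Nat.cast_nonneg k : (0 : ℝ) ≤ k)]
  have hrlim : Filter.Tendsto r Filter.atTop (nhds 0) := tendsto_one_div_add_atTop_nhds_zero_nat
  have hs0 : ∀ k t, 0 ≤ (1 - r k) • g t := fun k t => smul_nonneg (sub_nonneg.2 (hr1 k)) (hg0 t)
  set N : ℕ → Set T := fun k => {t | V t (x t) < V t ((1 - r k) • g t)}
  have hN : ∀ k, MeasurableSet (N k) := fun k =>
    measurableSet_lt (hV.measurable_comp hx hx0)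
      (hV.measurable_comp (x := (1 - r k) • g) (hg.const_smul _) (hs0 k))
  -- By continuity almost every agent can eventually afford to lose the share `r k`. A large `N k`
  -- therefore carries some of every commodity present, and only its members are shaved.
  have hev : ∀ᵐ t ∂ν, ∀ᶠ k in Filter.atTop, t ∈ N k := by
    filter_upwards [hlt] with t ht
    have h1 : Filter.Tendsto (fun k => (1 - r k) • g t) Filter.atTop (nhds (g t)) := by
      simpa using (hrlim.const_sub 1).smul_const (g t)
    have h2 : Filter.Tendsto (fun k => (1 - r k) • g t) Filter.atTop (nhdsWithin (g t) (Ici 0)) :=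
      tendsto_nhdsWithin_iff.2 ⟨h1, .of_forall fun k => hs0 k t⟩
    exact ((hV.continuousOn t (g t) (hg0 t)).tendsto.comp h2).eventually (lt_mem_nhds ht)
  have hlim : ∀ h, Filter.Tendsto (fun k => ∫ t, (N k).indicator (fun t => g t h) t ∂ν)
      Filter.atTop (nhds (∫ t, g t h ∂ν)) := by
    intro h
    refine tendsto_integral_of_dominated_convergence (fun t => ‖g t h‖)
      (fun k => ((hgi.eval h).indicator (hN k)).1) (hgi.eval h).norm
      (fun k => .of_forall fun t => norm_indicator_le_norm_self _ _) ?_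
    filter_upwards [hev] with t ht
    exact tendsto_const_nhds.congr' (ht.mono fun k hk => (indicator_of_mem hk _).symm)
  obtain ⟨k, hk⟩ : ∃ k, ∀ h, 0 < ∫ t, g t h ∂ν →
      0 < ∫ t, (N k).indicator (fun t => g t h) t ∂ν := by
    refine (Filter.eventually_all.2 fun h => ?_ : ∀ᶠ k in Filter.atTop, _).exists
    by_cases h0 : 0 < ∫ t, g t h ∂ν
    · exact ((hlim h).eventually (lt_mem_nhds h0)).mono fun k hk _ => hk
    · exact .of_forall fun k hk => absurd hk h0
  have hle : ∀ t, (N k).indicator g t ≤ g t := fun t => by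
    by_cases ht : t ∈ N k
    · simp [ht]
    · simpa [ht] using hg0 t
  have h0le : ∀ t, 0 ≤ (N k).indicator g t := fun t => indicator_nonneg (fun t _ => hg0 t) t
  have hsm : Measurable (r k • (N k).indicator g) := (hg.indicator (hN k)).const_smul _
  refine ⟨fun t => g t - r k • (N k).indicator g t, hg.sub hsm,
    fun t => ?_, fun t => ?_, ?_, fun h hh => ?_⟩
  · refine sub_nonneg.2 (le_trans ?_ (hle t))
    exact smul_le_of_le_one_left (h0le t) (hr1 k)
  · exact sub_le_self _ (smul_nonneg (hr0 k).le (h0le t))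
  · filter_upwards [hlt] with t ht
    by_cases htN : t ∈ N k
    · have : g t - r k • g t = (1 - r k) • g t := by rw [sub_smul, one_smul]
      rw [indicator_of_mem htN, this]
      exact htN
    · simpa [htN] using ht
  · have e1 : ∀ t, (g t - r k • (N k).indicator g t) h =
        g t h - r k * (N k).indicator (fun t => g t h) t := fun t => by
      by_cases htN : t ∈ N k <;> simp [htN]
    simp only [e1]
    rw [integral_sub (hgi.eval h) (((hgi.eval h).indicator (hN k)).const_mul _),
      integral_const_mul]
    linarith [mul_pos (hr0 k) (hk h hh)]

theorem integrable_of_nonneg_of_le {ν : Measure T} {x y : T → Fin ℓ → ℝ} (hx : Integrable x ν)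
    (hy : Measurable y) (hy0 : ∀ t, 0 ≤ y t) (hyx : ∀ t, y t ≤ x t) : Integrable y ν := by
  refine hx.mono hy.aestronglyMeasurable (.of_forall fun t => ?_)
  refine (pi_norm_le_iff_of_nonneg (norm_nonneg _)).2 fun i => ?_
  refine le_trans ?_ (norm_le_pi_norm (x t) i)
  rw [Real.norm_of_nonneg (hy0 t i), Real.norm_of_nonneg ((hy0 t i).trans (hyx t i))]
  exact hyx t i

/-- Superlevel sets are closed and convex, so they contain averages. -/
theorem le_apply_average_of_quasiconcaveOn {W : (Fin ℓ → ℝ) → ℝ} (hc : ContinuousOn W (Ici 0))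
    (hq : QuasiconcaveOn ℝ (Ici 0) W) {ν : Measure T} [IsFiniteMeasure ν] [NeZero ν]
    {x : T → Fin ℓ → ℝ} (hx0 : ∀ t, 0 ≤ x t) (hxi : Integrable x ν) {v : ℝ}
    (hle : ∀ᵐ t ∂ν, v ≤ W (x t)) : v ≤ W (⨍ t, x t ∂ν) := by
  have hcl : IsClosed {y | y ∈ Ici (0 : Fin ℓ → ℝ) ∧ v ≤ W y} :=
    hc.preimage_isClosed_of_isClosed isClosed_Ici isClosed_Ici
  exact ((hq v).average_mem hcl (hle.mono fun t ht => ⟨hx0 t, ht⟩) hxi).2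

theorem average_nonneg_of_nonneg {ν : Measure T} [IsFiniteMeasure ν] {x : T → Fin ℓ → ℝ}
    (hx0 : ∀ t, 0 ≤ x t) (hxi : Integrable x ν) : 0 ≤ ⨍ t, x t ∂ν := by
  intro h
  rw [average_eq, Pi.smul_apply, eval_integral fun i => hxi.eval i]
  exact smul_nonneg (by positivity) (integral_nonneg fun t => hx0 t h)

/-- The average of bundles that are weakly better than `z`, and strictly better with positive
probability, is strictly better than `z`. -/
theorem lt_apply_average_of_quasiconcaveOn {W : (Fin ℓ → ℝ) → ℝ} (hc : ContinuousOn W (Ici 0))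
    (hm : StrictMonoOn W (Ici 0)) (hq : QuasiconcaveOn ℝ (Ici 0) W) {ν : Measure T}
    [IsFiniteMeasure ν] [NeZero ν] {x : T → Fin ℓ → ℝ} (hx : Measurable x) (hx0 : ∀ t, 0 ≤ x t)
    (hxi : Integrable x ν) {z : Fin ℓ → ℝ} (hz : 0 ≤ z) (hle : ∀ᵐ t ∂ν, W z ≤ W (x t))
    (hpos : ν {t | W z < W (x t)} ≠ 0) : W z < W (⨍ t, x t ∂ν) := by
  have hU : IsUtility fun _ : T => W := .const hc hm
  set N : Set T := {t | W z < W (x t)}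
  have hN : MeasurableSet N := measurableSet_lt measurable_const (hU.measurable_comp hx hx0)
  have hav0 : 0 ≤ ⨍ t, x t ∂ν := average_nonneg_of_nonneg hx0 hxi
  -- If something is consumed on `N`, shaving there keeps every bundle weakly better than `z` but
  -- lowers the average, and monotonicity makes the inequality strict. Otherwise `x` vanishes on
  -- `N`, so already `W z < W 0`.
  by_cases hex : ∃ h, 0 < ∫ t in N, x t h ∂ν
  · obtain ⟨h, hh⟩ := hex
    obtain ⟨g, hg, hg0, hgx, hgW, hgi⟩ := hU.exists_improvement_integral_lt (ν := ν.restrict N)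
      (x := fun _ => z) measurable_const (fun _ => hz) hx hx0 hxi.integrableOn
      ((ae_restrict_iff' hN).2 (.of_forall fun t ht => ht))
    classical
    let y : T → Fin ℓ → ℝ := N.piecewise g x
    have hy : Measurable y := hg.piecewise hN hx
    have hy0 : ∀ t, 0 ≤ y t := fun t => by
      by_cases ht : t ∈ N <;> simp [y, ht, hg0, hx0]
    have hyx : ∀ t, y t ≤ x t := fun t => by
      by_cases ht : t ∈ N <;> simp [y, ht, hgx]
    have hyi : Integrable y ν := integrable_of_nonneg_of_le hxi hy hy0 hyx
    have hyW : ∀ᵐ t ∂ν, W z ≤ W (y t) := by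
      filter_upwards [hle, (ae_restrict_iff' hN).1 hgW] with t h1 h2
      by_cases ht : t ∈ N
      · simpa [y, ht] using (h2 ht).le
      · simpa [y, ht] using h1
    refine (le_apply_average_of_quasiconcaveOn hc hq hy0 hyi hyW).trans_lt ?_
    refine hm (average_nonneg_of_nonneg hy0 hyi) hav0 ?_
    have hν : 0 < (ν.real univ)⁻¹ := by
      rw [inv_pos, measureReal_def]
      exact ENNReal.toReal_pos (NeZero.ne _) (measure_ne_top _ _)
    rw [Pi.lt_def]
    simp only [Pi.le_def, average_eq, Pi.smul_apply, smul_eq_mul,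
      eval_integral fun i => hxi.eval i, eval_integral fun i => hyi.eval i]
    refine ⟨fun i => mul_le_mul_of_nonneg_left
      (integral_mono (hyi.eval i) (hxi.eval i) fun t => hyx t i) hν.le, h,
      mul_lt_mul_of_pos_left ?_ hν⟩
    rw [← integral_add_compl hN (hyi.eval h), ← integral_add_compl hN (hxi.eval h)]
    have e1 : ∫ t in N, y t h ∂ν = ∫ t in N, g t h ∂ν :=
      setIntegral_congr_fun hN fun t ht => by simp [y, ht]
    have e2 : ∫ t in Nᶜ, y t h ∂ν = ∫ t in Nᶜ, x t h ∂ν :=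
      setIntegral_congr_fun hN.compl fun t ht => by
        have : t ∉ N := ht
        simp [y, this]
    rw [e1, e2]
    linarith [hgi h hh]
  · push Not at hex
    have hzero : ∀ᵐ t ∂ν.restrict N, ∀ h, x t h = 0 := by
      refine ae_all_iff.2 fun h => ?_
      have h0 : ∫ t in N, x t h ∂ν = 0 := (hex h).antisymm (integral_nonneg fun t => hx0 t h)
      exact (integral_eq_zero_iff_of_nonneg (fun t => hx0 t h) (hxi.eval h).integrableOn).1 h0
    have : Filter.NeBot (ae (ν.restrict N)) := by
      rw [ae_neBot]
      simpa using hpos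
    obtain ⟨t, ht, htN⟩ := (hzero.and ((ae_restrict_iff' hN).2
      (.of_forall fun t (ht : t ∈ N) => ht))).exists
    have hx00 : x t = 0 := funext ht
    have : W z < W 0 := hx00 ▸ htN
    exact this.trans_le (hm.monotoneOn self_mem_Ici hav0 hav0)

end Utility

/-! ### Blocking coalitions and their fractional versions. -/

section Blocking

variable {T : Type*} [MeasurableSpace T] {ℓ : ℕ}

/-- In the market with utilities `V` and endowment `e`, the coalition `S` improves upon `x` by
distributing `y` among its members. -/
structure Blocks (μ : Measure T) (V : T → (Fin ℓ → ℝ) → ℝ) (e x : T → Fin ℓ → ℝ) (S : Set T)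
    (y : T → Fin ℓ → ℝ) : Prop where
  measurableSet : MeasurableSet S
  nonneg : ∀ t, 0 ≤ y t
  integrable : Integrable y μ
  integral_eq : ∫ t in S, y t ∂μ = ∫ t in S, e t ∂μ
  lt : ∀ᵐ t ∂μ.restrict S, V t (x t) < V t (y t)

variable {μ : Measure T} [IsFiniteMeasure μ] {V : T → (Fin ℓ → ℝ) → ℝ} {e x h k : T → Fin ℓ → ℝ}

/-- A surplus of every commodity can be distributed to turn weak into strict improvements. -/
theorem IsUtility.exists_blocks_of_setIntegral_lt [Nonempty (Fin ℓ)] (hV : IsUtility V)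
    {S : Set T} (hS : MeasurableSet S) (hk0 : ∀ t, 0 ≤ k t)
    (hki : Integrable k μ) (hei : Integrable e μ)
    (hle : ∀ᵐ t ∂μ.restrict S, V t (x t) ≤ V t (k t))
    (hlt : ∀ i, ∫ t in S, (k t i - e t i) ∂μ < 0) : ∃ y, Blocks μ V e x S y := by
  have hS0 : 0 < μ.real S := by
    refine lt_of_le_of_ne measureReal_nonneg fun h0 => ?_
    have : μ.restrict S = 0 := Measure.restrict_eq_zero.2
      ((measureReal_eq_zero_iff (measure_ne_top _ _)).1 h0.symm)
    simpa [this] using hlt (Classical.arbitrary _)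
  set d : Fin ℓ → ℝ := fun i => -(∫ t in S, (k t i - e t i) ∂μ) / μ.real S with hd
  have hd0 : ∀ i, 0 < d i := fun i => div_pos (neg_pos.2 (hlt i)) hS0
  have hdlt : ∀ t, k t < k t + d := fun t =>
    lt_add_of_pos_right _ (Pi.lt_def.2 ⟨fun i => (hd0 i).le, Classical.arbitrary _, hd0 _⟩)
  have hyi : Integrable (fun t => k t + d) μ := hki.add (integrable_const d)
  refine ⟨fun t => k t + d, hS, fun t => (hk0 t).trans (hdlt t).le, hyi, ?_, ?_⟩
  · ext i
    rw [eval_integral fun i => (hyi.eval i).integrableOn,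
      eval_integral fun i => (hei.eval i).integrableOn]
    have h1 : ∫ t in S, (k t i - e t i) ∂μ = ∫ t in S, k t i ∂μ - ∫ t in S, e t i ∂μ :=
      integral_sub (hki.eval i).integrableOn (hei.eval i).integrableOn
    have h2 : ∫ t in S, (k t + d) i ∂μ = ∫ t in S, k t i ∂μ + μ.real S * d i := by
      simp only [Pi.add_apply]
      rw [integral_add (hki.eval i).integrableOn (integrable_const _)]
      simp
    rw [h2, hd, mul_div_cancel₀ _ hS0.ne']
    linarith
  · filter_upwards [hle] with t ht
    exact ht.trans_lt (hV.strictMonoOn t (hk0 t) ((hk0 t).trans (hdlt t).le) (hdlt t))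

/-- A coalition in which agents of the atomless part `P` take part fractionally, a fraction `p` of
`S₀` with `h` and a fraction `q` of `P` with `k`, can be realized by a coalition. -/
theorem IsUtility.exists_blocks_of_fractional [Nonempty (Fin ℓ)] (hV : IsUtility V)
    {P A S₀ : Set T} (hP : MeasurableSet P) (hat : ∀ B ⊆ P, ¬ IsMeasureAtom μ B)
    (hA : MeasurableSet A) (hPA : Disjoint P A) (hS₀ : MeasurableSet S₀) (hS₀P : S₀ ⊆ P)
    (hh0 : ∀ t, 0 ≤ h t) (hk0 : ∀ t, 0 ≤ k t) (hhi : Integrable h μ)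
    (hki : Integrable k μ) (hei : Integrable e μ)
    (hh : ∀ᵐ t ∂μ.restrict S₀, V t (x t) ≤ V t (h t))
    (hk : ∀ᵐ t ∂μ.restrict (P ∪ A), V t (x t) ≤ V t (k t))
    {p q : ℝ} (hp : 0 ≤ p) (hq : 0 < q) (hpq : p + q ≤ 1)
    (hlt : ∀ i, p * ∫ t in S₀, (h t i - e t i) ∂μ + q * ∫ t in P, (k t i - e t i) ∂μ +
      ∫ t in A, (k t i - e t i) ∂μ < 0)
    {n : ℕ} {K : Fin n → Set T} (hK : ∀ j, MeasurableSet (K j))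
    (hKpos : ∀ j, 0 < μ (K j ∩ P) ∨ 0 < μ (K j ∩ A)) :
    ∃ S y, Blocks μ V e x S y ∧ ∀ j, 0 < μ (K j ∩ S) := by
  classical
  have hhe : ∀ i, Integrable (fun t => h t i - e t i) μ := fun i => (hhi.eval i).sub (hei.eval i)
  have hke : ∀ i, Integrable (fun t => k t i - e t i) μ := fun i => (hki.eval i).sub (hei.eval i)
  -- One vector integrand controls both excess demands and the masses of the `K j`. The coalition
  -- will be `(B ∩ S₀) ∪ C ∪ A`; its excess demand errs by less than `2 * η`.
  let φ : (Fin ℓ ⊕ Fin ℓ) ⊕ Fin n → T → ℝ := Sum.elim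
    (Sum.elim (fun i => S₀.indicator fun t => h t i - e t i) fun i t => k t i - e t i)
    fun j => (K j).indicator fun _ => 1
  have hφ : ∀ c, Integrable (φ c) μ := by
    rintro ((i | i) | j)
    · exact (hhe i).indicator hS₀
    · exact hke i
    · exact (integrable_const _).indicator (hK j)
  have hΦ : IntegrableOn (fun t c => φ c t) P μ := (Integrable.of_eval hφ).integrableOn
  obtain ⟨η, hη, hη1, hη2⟩ : ∃ η : ℝ, 0 < η ∧
      (∀ i, 2 * η < -(p * ∫ t in S₀, (h t i - e t i) ∂μ + q * ∫ t in P, (k t i - e t i) ∂μ +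
        ∫ t in A, (k t i - e t i) ∂μ)) ∧
      ∀ j, 0 < q * μ.real (K j ∩ P) → η < q * μ.real (K j ∩ P) := by
    have hid : Filter.Tendsto (fun η : ℝ => η) (nhdsWithin 0 (Ioi 0)) (nhds 0) := nhdsWithin_le_nhds
    have hid2 : Filter.Tendsto (fun η : ℝ => 2 * η) (nhdsWithin 0 (Ioi 0)) (nhds 0) := by
      simpa using hid.const_mul 2
    have hpos : ∀ᶠ η : ℝ in nhdsWithin 0 (Ioi 0), 0 < η := self_mem_nhdsWithin
    refine (hpos.and (Filter.Eventually.and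
      (Filter.eventually_all.2 fun i => ?_) (Filter.eventually_all.2 fun j => ?_))).exists
    · exact hid2.eventually (gt_mem_nhds (neg_pos.2 (hlt i)))
    · by_cases h0 : 0 < q * μ.real (K j ∩ P)
      · exact (hid.eventually (gt_mem_nhds h0)).mono fun _ h _ => h
      · exact .of_forall fun _ h => absurd h h0
  obtain ⟨B, hBP, C, hCP, hB, hC, hBC, hBη, hCη⟩ :=
    exists_disjoint_subsets_norm_setIntegral_sub_lt hP hat hΦ hp hq.le hpq hη
  have hcoord : ∀ (D : Set T) (r : ℝ),
      ‖∫ t in D, (fun c => φ c t) ∂μ - r • ∫ t in P, (fun c => φ c t) ∂μ‖ < η →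
      ∀ c, |∫ t in D, φ c t ∂μ - r * ∫ t in P, φ c t ∂μ| < η := by
    intro D r hD c
    have := (norm_le_pi_norm _ c).trans_lt hD
    rwa [Pi.sub_apply, Pi.smul_apply, eval_integral fun c => (hφ c).integrableOn,
      eval_integral fun c => (hφ c).integrableOn, Real.norm_eq_abs, smul_eq_mul] at this
  have hB' := hcoord B p hBη
  have hC' := hcoord C q hCη
  set R : Set T := B ∩ S₀
  have hR : MeasurableSet R := hB.inter hS₀
  have hCA : Disjoint C A := hPA.mono_left hCP
  have hRCA : Disjoint R (C ∪ A) := disjoint_union_right.2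
    ⟨hBC.mono_left inter_subset_left, hPA.mono_left (inter_subset_left.trans hBP)⟩
  let y : T → Fin ℓ → ℝ := R.piecewise h k
  have hyi : Integrable y μ := Integrable.piecewise hR hhi.integrableOn hki.integrableOn
  have hye : ∀ i, Integrable (fun t => y t i - e t i) μ := fun i => (hyi.eval i).sub (hei.eval i)
  have hyR : ∀ i, ∫ t in R, (y t i - e t i) ∂μ = ∫ t in R, (h t i - e t i) ∂μ := fun i =>
    setIntegral_congr_fun hR fun t ht => by simp [y, ht]
  have hyCA : ∀ D, MeasurableSet D → D ⊆ C ∪ A → ∀ i,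
      ∫ t in D, (y t i - e t i) ∂μ = ∫ t in D, (k t i - e t i) ∂μ := fun D hD hDs i =>
    setIntegral_congr_fun hD fun t ht => by
      have : t ∉ R := fun htR => Set.disjoint_left.1 hRCA htR (hDs ht)
      simp [y, this]
  have hS : MeasurableSet (R ∪ (C ∪ A)) := hR.union (hC.union hA)
  obtain ⟨z, hz⟩ := hV.exists_blocks_of_setIntegral_lt (μ := μ) (k := y) (e := e) hS
    (fun t => by by_cases ht : t ∈ R <;> simp [y, ht, hh0, hk0]) hyi hei
    (by
      rw [ae_restrict_iff' hS]
      filter_upwards [(ae_restrict_iff' hS₀).1 hh, (ae_restrict_iff' (hP.union hA)).1 hk]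
        with t h1 h2 ht
      by_cases htR : t ∈ R
      · simpa [y, htR] using h1 htR.2
      · have : t ∈ P ∪ A := (ht.resolve_left htR).imp (fun h => hCP h) id
        simpa [y, htR] using h2 this)
    (fun i => by
      rw [setIntegral_union hRCA (hC.union hA) (hye i).integrableOn (hye i).integrableOn,
        setIntegral_union hCA hA (hye i).integrableOn (hye i).integrableOn, hyR,
        hyCA C hC subset_union_left, hyCA A hA subset_union_right]
      have e1 := abs_lt.1 (hB' (.inl (.inl i)))
      have e2 := abs_lt.1 (hC' (.inl (.inr i)))
      simp only [φ, Sum.elim_inl, Sum.elim_inr, setIntegral_indicator hS₀,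
        inter_eq_self_of_subset_right hS₀P] at e1 e2
      linarith [hη1 i, e1.2, e2.2])
  refine ⟨_, z, hz, fun j => ?_⟩
  rcases hKpos j with h | h
  · have hpos : 0 < q * μ.real (K j ∩ P) :=
      mul_pos hq (ENNReal.toReal_pos h.ne' (measure_ne_top _ _))
    have e3 := abs_lt.1 (hC' (.inr j))
    simp only [φ, Sum.elim_inr, setIntegral_indicator (hK j), integral_const, smul_eq_mul, mul_one,
      measureReal_restrict_apply MeasurableSet.univ, univ_inter] at e3
    rw [inter_comm P] at e3
    have : 0 < μ.real (C ∩ K j) := by linarith [hη2 j hpos, e3.1]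
    have h4 : 0 < μ (C ∩ K j) := by
      rw [pos_iff_ne_zero]
      intro h0
      simp [measureReal_def, h0] at this
    refine h4.trans_le (measure_mono ?_)
    rintro t ⟨h1, h2⟩
    exact ⟨h2, .inr (.inl h1)⟩
  · exact h.trans_le (measure_mono (inter_subset_inter_right _
      (subset_union_right.trans subset_union_right)))

end Blocking

/-! ### Blocking coalitions in markets with small and large agents. -/

section MixedMarket

variable {T : Type*} [MeasurableSpace T] {ℓ : ℕ}

theorem integral_pos_of_ae_pos {ν : Measure T} [NeZero ν] {φ : T → ℝ} (hi : Integrable φ ν)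
    (hpos : ∀ᵐ t ∂ν, 0 < φ t) : 0 < ∫ t, φ t ∂ν := by
  have hnn : 0 ≤ᵐ[ν] φ := hpos.mono fun t ht => ht.le
  refine lt_of_le_of_ne (integral_nonneg_of_ae hnn) fun h0 => ?_
  obtain ⟨t, h1, h2⟩ := (hpos.and ((integral_eq_zero_iff_of_nonneg_ae hnn hi).1 h0.symm)).exists
  exact h1.ne' h2

variable {μ : Measure T} [IsFiniteMeasure μ] {V : T → (Fin ℓ → ℝ) → ℝ} {e x g : T → Fin ℓ → ℝ}

/-- Positive endowments mean that `S` distributes some of every commodity, so shaving leaves a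
surplus of each. -/
theorem Blocks.exists_setIntegral_lt {μ : Measure T} {S : Set T} (hb : Blocks μ V e x S g)
    (hV : IsUtility V) (hx : Measurable x) (hx0 : ∀ t, 0 ≤ x t) (hg : Measurable g) (hei : Integrable e μ)
    (hepos : ∀ᵐ t ∂μ, ∀ i, 0 < e t i) (hS : μ S ≠ 0) :
    ∃ v : T → Fin ℓ → ℝ, Measurable v ∧ (∀ t, 0 ≤ v t) ∧ Integrable v μ ∧
      (∀ᵐ t ∂μ.restrict S, V t (x t) < V t (v t)) ∧
      ∀ i, ∫ t in S, (v t i - e t i) ∂μ < 0 := by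
  obtain ⟨v, hv, hv0, hle, hlt, hneg⟩ := hV.exists_improvement_integral_lt (ν := μ.restrict S)
    hx hx0 hg hb.nonneg hb.integrable.integrableOn hb.lt
  have hvi : Integrable v μ := integrable_of_nonneg_of_le hb.integrable hv hv0 hle
  have : NeZero (μ.restrict S) := ⟨by simpa using hS⟩
  refine ⟨v, hv, hv0, hvi, hlt, fun i => ?_⟩
  have heq : ∫ t in S, g t i ∂μ = ∫ t in S, e t i ∂μ := by
    have := congrFun hb.integral_eq i
    rwa [eval_integral fun i => (hb.integrable.eval i).integrableOn,
      eval_integral fun i => (hei.eval i).integrableOn] at this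
  have hpos : 0 < ∫ t in S, e t i ∂μ := integral_pos_of_ae_pos (hei.eval i).integrableOn
    (ae_restrict_of_ae (hepos.mono fun t ht => ht i))
  have := hneg i (heq ▸ hpos)
  rw [integral_sub (hvi.eval i).integrableOn (hei.eval i).integrableOn]
  linarith

/-- In an atomless market every blocked allocation is blocked by a coalition that meets all given
non-negligible sets of agents. -/
theorem Blocks.exists_meeting_of_atomless [Nonempty (Fin ℓ)] {S : Set T}
    (hb : Blocks μ V e x S g) (hV : IsUtility V) (hat : ∀ B : Set T, ¬ IsMeasureAtom μ B)
    (hx : Measurable x) (hx0 : ∀ t, 0 ≤ x t) (hxi : Integrable x μ) (hg : Measurable g)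
    (hei : Integrable e μ) (hepos : ∀ᵐ t ∂μ, ∀ i, 0 < e t i)
    (hfeas : ∫ t, x t ∂μ = ∫ t, e t ∂μ) (hS : μ S ≠ 0) {n : ℕ} {K : Fin n → Set T}
    (hK : ∀ j, MeasurableSet (K j)) (hKpos : ∀ j, 0 < μ (K j)) :
    ∃ S' y, Blocks μ V e x S' y ∧ ∀ j, 0 < μ (K j ∩ S') := by
  obtain ⟨v, hv, hv0, hvi, hlt, hneg⟩ :=
    hb.exists_setIntegral_lt hV hx hx0 hg hei hepos hS
  refine hV.exists_blocks_of_fractional (P := univ) (A := ∅) (S₀ := S) (h := v) (k := x)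
    (p := 1 / 2) (q := 1 / 2) .univ (fun B _ => hat B) .empty (disjoint_empty _) hb.measurableSet
    (subset_univ _) hv0 hx0 hvi hxi hei (hlt.mono fun t ht => ht.le) (.of_forall fun t => le_rfl)
    (by norm_num) (by norm_num) (by norm_num) (fun i => ?_) hK
    (fun j => .inl (by simpa using hKpos j))
  have hfi := congrFun hfeas i
  rw [eval_integral fun i => hxi.eval i, eval_integral fun i => hei.eval i] at hfi
  rw [setIntegral_univ, integral_sub (hxi.eval i) (hei.eval i), hfi]
  simp only [sub_self, mul_zero, add_zero, Measure.restrict_empty, integral_zero_measure]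
  linarith [hneg i]

variable {W : (Fin ℓ → ℝ) → ℝ} {e₁ : Fin ℓ → ℝ} {P A : Set T}

/-- If a set `A` of large agents is treated worse than the average large agent, then it can improve
together with a fraction of the small agents. -/
theorem IsUtility.exists_blocks_of_lt_average [Nonempty (Fin ℓ)] (hV : IsUtility V)
    (hP : MeasurableSet P) (hat : ∀ B ⊆ P, ¬ IsMeasureAtom μ B) (hA : MeasurableSet A)
    (hAP : A ⊆ Pᶜ) (hA0 : μ A ≠ 0) (hW : ∀ t ∈ Pᶜ, ∀ y, 0 ≤ y → V t y = W y)
    (he₁ : ∀ t ∈ Pᶜ, e t = e₁) (hx : Measurable x) (hx0 : ∀ t, 0 ≤ x t) (hxi : Integrable x μ)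
    (hei : Integrable e μ) (hepos : ∀ᵐ t ∂μ, ∀ i, 0 < e t i)
    (hfeas : ∫ t, x t ∂μ = ∫ t, e t ∂μ)
    (hlt : ∀ᵐ t ∂μ.restrict A, V t (x t) < W (⨍ s in Pᶜ, x s ∂μ)) {n : ℕ} {K : Fin n → Set T}
    (hK : ∀ j, MeasurableSet (K j)) (hKpos : ∀ j, 0 < μ (K j ∩ P) ∨ 0 < μ (K j ∩ A)) :
    ∃ S y, Blocks μ V e x S y ∧ ∀ j, 0 < μ (K j ∩ S) := by
  classical
  set z : Fin ℓ → ℝ := ⨍ s in Pᶜ, x s ∂μ with hz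
  have hz0 : 0 ≤ z := average_nonneg_of_nonneg hx0 hxi.integrableOn
  set m := μ.real A
  set M := μ.real Pᶜ
  have hm : 0 < m := ENNReal.toReal_pos hA0 (measure_ne_top _ _)
  have hmM : m ≤ M := measureReal_mono hAP
  have hM : 0 < M := hm.trans_le hmM
  have : NeZero (μ.restrict A) := ⟨by simpa using hA0⟩
  have : NeZero μ := ⟨fun h => hA0 (by simp [h])⟩
  have hltA : ∀ᵐ t ∂μ.restrict A, V t (x t) < V t z := by
    filter_upwards [hlt, ae_restrict_mem hA] with t ht htA
    rwa [hW t (hAP htA) z hz0]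
  obtain ⟨g, hg, hg0, hgz, hgV, hgi⟩ := hV.exists_improvement_integral_lt (ν := μ.restrict A)
    (g := fun _ => z) hx hx0 measurable_const (fun _ => hz0) (integrable_const z) hltA
  have hgint : Integrable g μ := integrable_of_nonneg_of_le (integrable_const z) hg hg0 hgz
  -- the surplus left by `A`
  set d : Fin ℓ → ℝ := fun i => m * z i - ∫ t in A, g t i ∂μ with hd
  have hconst : ∀ i, ∫ _ in A, z i ∂μ = m * z i := fun i => by simp [m]
  have hd0 : 0 ≤ d := fun i => by
    have := setIntegral_mono (s := A) (hgint.eval i).integrableOn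
      (integrable_const (μ := μ) (z i)).integrableOn fun t => hgz t i
    rw [hconst] at this
    exact sub_nonneg.2 this
  have hdpos : ∃ i, 0 < d i := by
    have hzne : ∃ i, 0 < z i := by
      by_contra hcon
      push Not at hcon
      have hz00 : z = 0 := le_antisymm hcon hz0
      obtain ⟨t, ht⟩ := hltA.exists
      rw [hz00] at ht
      exact absurd ht (not_lt.2 ((hV.strictMonoOn t).monotoneOn self_mem_Ici (hx0 t) (hx0 t)))
    obtain ⟨i, hi⟩ := hzne
    refine ⟨i, ?_⟩
    have := hgi i (by rw [hconst]; positivity)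
    rw [hconst] at this
    exact sub_pos.2 this
  -- With this fraction, `x` for the small agents and `z` for `A` balance: the total is `q` times
  -- that of the grand coalition, and large endowments are equal.
  set q := m / M
  have hq : 0 < q := by positivity
  have hq1 : q ≤ 1 := (div_le_one hM).2 hmM
  -- The mass of the fractional coalition, over which the surplus `d` is spread evenly.
  set w := q * μ.real P + m
  have hw : 0 < w := by positivity
  set c : Fin ℓ → ℝ := w⁻¹ • d
  have hc : 0 < c := Pi.lt_def.2 ⟨fun i => mul_nonneg (inv_pos.2 hw).le (hd0 i),
    hdpos.imp fun i hi => mul_pos (inv_pos.2 hw) hi⟩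
  let b : T → Fin ℓ → ℝ := fun t => P.piecewise x g t + c
  have hb : Measurable b := (hx.piecewise hP hg).add measurable_const
  have hpw0 : ∀ t, 0 ≤ P.piecewise x g t := fun t => by
    by_cases ht : t ∈ P <;> simp [ht, hx0, hg0]
  have hb0 : ∀ t, 0 ≤ b t := fun t => add_nonneg (hpw0 t) hc.le
  have hbi : Integrable b μ :=
    (Integrable.piecewise hP hxi.integrableOn hgint.integrableOn).add (integrable_const c)
  let ν : Measure T := ENNReal.ofReal q • μ.restrict P + μ.restrict A
  have hνint : ∀ φ : T → ℝ, Integrable φ μ →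
      ∫ t, φ t ∂ν = q * ∫ t in P, φ t ∂μ + ∫ t in A, φ t ∂μ := by
    intro φ hφ
    rw [integral_add_measure (hφ.integrableOn.smul_measure ENNReal.ofReal_ne_top) hφ.integrableOn,
      integral_smul_measure, ENNReal.toReal_ofReal hq.le, smul_eq_mul]
  have hνi : Integrable b ν :=
    (hbi.integrableOn.smul_measure ENNReal.ofReal_ne_top).add_measure hbi.integrableOn
  have hνae : ∀ p : T → Prop, (∀ᵐ t ∂ν, p t) ↔
      (∀ᵐ t ∂μ.restrict P, p t) ∧ ∀ᵐ t ∂μ.restrict A, p t := by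
    intro p
    rw [ae_add_measure_iff, Measure.ae_ennreal_smul_measure_iff (by simpa using hq)]
  have hsplit : ∀ φ : T → ℝ, Integrable φ μ →
      ∫ t, φ t ∂μ = ∫ t in P, φ t ∂μ + ∫ t in Pᶜ, φ t ∂μ := fun φ hφ =>
    (integral_add_compl hP hφ).symm
  have hzM : ∀ i, M * z i = ∫ t in Pᶜ, x t i ∂μ := fun i => by
    rw [hz, setAverage_eq, Pi.smul_apply, eval_integral fun i => (hxi.eval i).integrableOn,
      smul_eq_mul, mul_inv_cancel_left₀ hM.ne']
  have hb_int : ∀ i, ∫ t, b t i ∂ν = q * ∫ t, e t i ∂μ := by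
    intro i
    have h1 : ∫ t in P, b t i ∂μ = ∫ t in P, x t i ∂μ + μ.real P * c i := by
      rw [setIntegral_congr_fun hP (g := fun t => x t i + c i) fun t ht => by simp [b, ht],
        integral_add (hxi.eval i).integrableOn (integrable_const _)]
      simp
    have h2 : ∫ t in A, b t i ∂μ = ∫ t in A, g t i ∂μ + m * c i := by
      rw [setIntegral_congr_fun hA (g := fun t => g t i + c i) fun t ht => by
          have : t ∉ P := hAP ht
          simp [b, this],
        integral_add (hgint.eval i).integrableOn (integrable_const _)]
      simp [m]
    have hfi := congrFun hfeas i
    rw [eval_integral fun i => hxi.eval i, eval_integral fun i => hei.eval i,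
      hsplit _ (hxi.eval i), ← hzM] at hfi
    have hwc : w * c i = d i := by simp [c, hw.ne']
    have hqM : q * M = m := div_mul_cancel₀ _ hM.ne'
    have hdi : d i = m * z i - ∫ t in A, g t i ∂μ := rfl
    rw [hνint _ (hbi.eval i), h1, h2, ← hfi]
    have hw' : w * c i = q * μ.real P * c i + m * c i := add_mul _ _ _
    linear_combination hwc - hw' - z i * hqM + hdi
  have hbV : ∀ᵐ t ∂ν, V t (x t) < V t (b t) := by
    rw [hνae]
    constructor
    · filter_upwards [ae_restrict_mem hP] with t ht
      refine hV.strictMonoOn t (hx0 t) (hb0 t) ?_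
      simpa [b, ht] using hc
    · filter_upwards [ae_restrict_mem hA, hgV] with t ht htV
      have htP : t ∉ P := hAP ht
      refine htV.trans (hV.strictMonoOn t (hg0 t) (hb0 t) ?_)
      simpa [b, htP] using hc
  -- `b` is balanced and strictly better for all, so a second shaving gives a surplus of every
  -- commodity; the first may have given one of only some.
  obtain ⟨k, hk, hk0, hkb, hkV, hki⟩ :=
    hV.exists_improvement_integral_lt hx hx0 hb hb0 hνi hbV
  have hkint : Integrable k μ := integrable_of_nonneg_of_le hbi hk hk0 hkb
  refine hV.exists_blocks_of_fractional (A := A) (S₀ := ∅) (h := k) (k := k) (p := 0) (q := q)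
    hP hat hA (disjoint_compl_right.mono_right hAP) .empty (empty_subset _) hk0 hk0 hkint hkint hei
    (by simp) ?_ le_rfl hq (by simpa using hq1) (fun i => ?_) hK hKpos
  · rw [ae_restrict_union_iff]
    exact ((hνae _).1 hkV).imp (·.mono fun t ht => ht.le) (·.mono fun t ht => ht.le)
  · have hpos : 0 < ∫ t, e t i ∂μ :=
      integral_pos_of_ae_pos (hei.eval i) (hepos.mono fun t ht => ht i)
    have h1 := hki i (by rw [hb_int]; positivity)
    rw [hb_int, hνint _ (hkint.eval i), hsplit _ (hei.eval i)] at h1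
    have h2 : ∫ t in Pᶜ, e t i ∂μ = M * e₁ i := by
      rw [setIntegral_congr_fun hP.compl (g := fun _ => e₁ i) fun t ht => by simp [he₁ t ht]]
      simp [M]
    have h3 : ∫ t in A, e t i ∂μ = m * e₁ i := by
      rw [setIntegral_congr_fun hA (g := fun _ => e₁ i) fun t ht => by simp [he₁ t (hAP ht)]]
      simp [m]
    have hqM : q * M = m := div_mul_cancel₀ _ hM.ne'
    have h4 : q * (M * e₁ i) = m * e₁ i := by rw [← mul_assoc, hqM]
    rw [zero_mul, zero_add, integral_sub (hkint.eval i).integrableOn (hei.eval i).integrableOn,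
      integral_sub (hkint.eval i).integrableOn (hei.eval i).integrableOn, h3]
    rw [h2, mul_add, h4] at h1
    linarith

/-- If all large agents are indifferent to their average bundle, then any blocking coalition can be
replaced by one whose only large agents are those of `A`. -/
theorem Blocks.exists_meeting_of_eq_average [Nonempty (Fin ℓ)] {S : Set T}
    (hb : Blocks μ V e x S g) (hV : IsUtility V)
    (hP : MeasurableSet P) (hat : ∀ B ⊆ P, ¬ IsMeasureAtom μ B) (hA : MeasurableSet A)
    (hAP : A ⊆ Pᶜ) (hA0 : μ A ≠ 0) (hAlt : μ.real A < μ.real Pᶜ)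
    (hW : ∀ t ∈ Pᶜ, ∀ y, 0 ≤ y → V t y = W y)
    (hWc : ContinuousOn W (Ici 0)) (hWq : QuasiconcaveOn ℝ (Ici 0) W)
    (he₁ : ∀ t ∈ Pᶜ, e t = e₁) (hx : Measurable x) (hx0 : ∀ t, 0 ≤ x t) (hxi : Integrable x μ)
    (hg : Measurable g) (hei : Integrable e μ) (hepos : ∀ᵐ t ∂μ, ∀ i, 0 < e t i)
    (hfeas : ∫ t, x t ∂μ = ∫ t, e t ∂μ) (hS : μ S ≠ 0)
    (heq : ∀ᵐ t ∂μ.restrict Pᶜ, V t (x t) = W (⨍ s in Pᶜ, x s ∂μ)) {n : ℕ} {K : Fin n → Set T}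
    (hK : ∀ j, MeasurableSet (K j)) (hKpos : ∀ j, 0 < μ (K j ∩ P) ∨ 0 < μ (K j ∩ A)) :
    ∃ S' y, Blocks μ V e x S' y ∧ ∀ j, 0 < μ (K j ∩ S') := by
  classical
  obtain ⟨v, hv, hv0, hvi, hlt, hneg⟩ :=
    hb.exists_setIntegral_lt hV hx hx0 hg hei hepos hS
  have hSm := hb.measurableSet
  set z : Fin ℓ → ℝ := ⨍ s in Pᶜ, x s ∂μ with hz
  have hz0 : 0 ≤ z := average_nonneg_of_nonneg hx0 hxi.integrableOn
  set m := μ.real A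
  set M := μ.real Pᶜ
  have hm : 0 < m := ENNReal.toReal_pos hA0 (measure_ne_top _ _)
  have hM : 0 < M := hm.trans hAlt
  set β := μ.real (S ∩ Pᶜ)
  have hβ : 0 ≤ β := measureReal_nonneg
  -- Weights `ε` on `S` and `1 - ε` on the grand coalition give large mass `ε * β + (1 - ε) * M = ε
  -- * β + m = w`; the factor `r = m / w` scales it to the mass of `A`.
  set ε := 1 - m / M with hε
  have hε0 : 0 < ε := by rw [hε, sub_pos, div_lt_one hM]; exact hAlt
  have hεM : (1 - ε) * M = m := by rw [hε]; field_simp; ring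
  have hε1 : 0 < 1 - ε := by rw [hε]; simp only [sub_sub_cancel]; positivity
  set w := ε * β + m
  have hw : 0 < w := by positivity
  set r := m / w
  have hr : 0 < r := by positivity
  have hr1 : r ≤ 1 := (div_le_one hw).2 (le_add_of_nonneg_left (by positivity))
  have hrw : r * w = m := div_mul_cancel₀ _ hw.ne'
  set u : Fin ℓ → ℝ := ⨍ s in S ∩ Pᶜ, v s ∂μ with hu
  have hu0 : 0 ≤ u := average_nonneg_of_nonneg hv0 hvi.integrableOn
  -- The average bundle of the large part of the weighted coalition.
  set y : Fin ℓ → ℝ := (ε * β / w) • u + (m / w) • z with hy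
  have hy0 : 0 ≤ y := add_nonneg (smul_nonneg (by positivity) hu0) (smul_nonneg hr.le hz0)
  have hWy : W z ≤ W y := by
    by_cases hβ0 : β = 0
    · have : y = z := by simp [hy, w, hβ0, hm.ne']
      rw [this]
    · have hne : NeZero (μ.restrict (S ∩ Pᶜ)) := ⟨by
        rw [Ne, Measure.restrict_eq_zero]
        exact fun h => hβ0 (by simp [β, measureReal_def, h])⟩
      have hWu : W z ≤ W u := by
        refine le_apply_average_of_quasiconcaveOn hWc hWq hv0 hvi.integrableOn ?_
        rw [ae_restrict_iff' (hSm.inter hP.compl)]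
        filter_upwards [(ae_restrict_iff' hSm).1 hlt, (ae_restrict_iff' hP.compl).1 heq]
          with t h1 h2 ht
        rw [← h2 ht.2, ← hW t ht.2 _ (hv0 t)]
        exact (h1 ht.1).le
      refine ((hWq (W z)) ⟨hu0, hWu⟩ ⟨hz0, le_rfl⟩ (by positivity) (by positivity) ?_).2
      rw [← add_div, div_self hw.ne']
  refine hV.exists_blocks_of_fractional (A := A) (S₀ := S ∩ P) (h := v)
    (k := P.piecewise x fun _ => y) (p := r * ε) (q := r * (1 - ε)) hP hat hA
    (disjoint_compl_right.mono_right hAP) (hSm.inter hP) inter_subset_right hv0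
    (fun t => by by_cases ht : t ∈ P <;> simp [ht, hx0, hy0]) hvi
    (Integrable.piecewise hP hxi.integrableOn (integrable_const _).integrableOn) hei ?_ ?_
    (by positivity) (by positivity) (by linarith) (fun i => ?_) hK hKpos
  · exact (ae_restrict_of_ae_restrict_of_subset inter_subset_left hlt).mono fun t ht => ht.le
  · rw [ae_restrict_union_iff]
    constructor
    · filter_upwards [ae_restrict_mem hP] with t ht
      simp [ht]
    · filter_upwards [ae_restrict_mem hA, ae_restrict_of_ae_restrict_of_subset hAP heq]
        with t ht h2
      have htP : t ∉ P := hAP ht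
      rw [h2, piecewise_eq_of_notMem _ _ _ htP, hW t htP _ hy0]
      exact hWy
  · have hxe : Integrable (fun t => x t i - e t i) μ := (hxi.eval i).sub (hei.eval i)
    have hge : Integrable (fun t => v t i - e t i) μ := (hvi.eval i).sub (hei.eval i)
    have h1 : ∫ t in P, (P.piecewise x (fun _ => y) t i - e t i) ∂μ =
        ∫ t in P, (x t i - e t i) ∂μ := setIntegral_congr_fun hP fun t ht => by simp [ht]
    have h2 : ∫ t in A, (P.piecewise x (fun _ => y) t i - e t i) ∂μ = m * (y i - e₁ i) := by
      rw [setIntegral_congr_fun hA (g := fun _ => y i - e₁ i) fun t ht => by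
        have htP : t ∉ P := hAP ht
        simp [htP, he₁ t (hAP ht)]]
      simp [m]
    have hsum : ∫ t in P, (x t i - e t i) ∂μ + M * (z i - e₁ i) = 0 := by
      have hfi := congrFun hfeas i
      rw [eval_integral fun i => hxi.eval i, eval_integral fun i => hei.eval i] at hfi
      have h3 : ∫ t in Pᶜ, (x t i - e t i) ∂μ = M * (z i - e₁ i) := by
        rw [setIntegral_congr_fun hP.compl (g := fun t => x t i - e₁ i) fun t ht => by
            simp [he₁ t ht],
          integral_sub (hxi.eval i).integrableOn (integrable_const _), mul_sub, hz, setAverage_eq,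
          Pi.smul_apply, eval_integral fun i => (hxi.eval i).integrableOn, smul_eq_mul,
          mul_inv_cancel_left₀ hM.ne']
        simp [M]
      rw [← h3, integral_add_compl hP hxe, integral_sub (hxi.eval i) (hei.eval i), hfi, sub_self]
    have hsumS : ∫ t in S ∩ P, (v t i - e t i) ∂μ + β * (u i - e₁ i) =
        ∫ t in S, (v t i - e t i) ∂μ := by
      have h3 : ∫ t in S ∩ Pᶜ, (v t i - e t i) ∂μ = β * (u i - e₁ i) := by
        have h4 : β * u i = ∫ t in S ∩ Pᶜ, v t i ∂μ := by
          rw [hu, setAverage_eq, Pi.smul_apply,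
            eval_integral fun i => (hvi.eval i).integrableOn, smul_eq_mul]
          by_cases hβ0 : β = 0
          · have : μ.restrict (S ∩ Pᶜ) = 0 := Measure.restrict_eq_zero.2
              ((measureReal_eq_zero_iff (measure_ne_top _ _)).1 hβ0)
            simp [this]
          · rw [mul_inv_cancel_left₀ hβ0]
        rw [setIntegral_congr_fun (hSm.inter hP.compl) (g := fun t => v t i - e₁ i) fun t ht => by
            simp [he₁ t ht.2],
          integral_sub (hvi.eval i).integrableOn (integrable_const _), mul_sub, h4]
        simp [β]
      rw [← h3, ← sdiff_eq, integral_inter_add_sdiff hP hge.integrableOn]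
    have hmy : m * y i = r * (ε * β * u i + m * z i) := by
      simp only [hy, r, Pi.add_apply, Pi.smul_apply, smul_eq_mul]
      field_simp
    rw [h1, h2]
    have hneg' := mul_neg_of_pos_of_neg (mul_pos hr hε0) (hneg i)
    rw [← hsumS] at hneg'
    -- The grand coalition contributes no excess demand; only `r * ε` times that of `S` remains.
    have key : r * ε * ∫ t in S ∩ P, (v t i - e t i) ∂μ +
        r * (1 - ε) * ∫ t in P, (x t i - e t i) ∂μ + m * (y i - e₁ i) =
        r * ε * (∫ t in S ∩ P, (v t i - e t i) ∂μ + β * (u i - e₁ i)) := by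
      have hw' : w = ε * β + m := rfl
      linear_combination hmy + r * (1 - ε) * hsum - r * (z i - e₁ i) * hεM + e₁ i * hrw -
        r * e₁ i * hw'
    rw [key]
    exact hneg'

end MixedMarket

/-! ### Coalitions meeting all information types. -/

section LargeAgents

variable {T : Type*} [MeasurableSpace T] {ℓ : ℕ} {μ : Measure T} [IsFiniteMeasure μ]
  {V : T → (Fin ℓ → ℝ) → ℝ} {e x g : T → Fin ℓ → ℝ}

theorem AtomDecomposition.measurableSet_large {μ : Measure T} (D : AtomDecomposition μ) :
    MeasurableSet D.large :=
  .sUnion D.countable fun A hA => (D.isAtom A hA).1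

/-- In a mixed market without large agents, or with at least two large agents all of the same type,
every blocked allocation is blocked by a coalition that meets all given non-negligible sets of
agents, provided that these do not separate the large agents. -/
theorem Blocks.exists_meeting [Nonempty (Fin ℓ)] {S : Set T} (hb : Blocks μ V e x S g)
    (hV : IsUtility V) (D : AtomDecomposition μ)
    (hsame : ∀ t ∈ D.large, ∀ s ∈ D.large, (∀ y, 0 ≤ y → V t y = V s y) ∧ e t = e s)
    (hquasi : ∀ t ∈ D.large, QuasiconcaveOn ℝ (Ici 0) (V t))
    (hatoms : D.atoms.Nontrivial ∨ D.atoms = ∅)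
    (hx : Measurable x) (hx0 : ∀ t, 0 ≤ x t) (hxi : Integrable x μ) (hg : Measurable g)
    (hei : Integrable e μ) (hepos : ∀ᵐ t ∂μ, ∀ i, 0 < e t i)
    (hfeas : ∫ t, x t ∂μ = ∫ t, e t ∂μ) (hS : μ S ≠ 0) {n : ℕ} {K : Fin n → Set T}
    (hK : ∀ j, MeasurableSet (K j)) (hKpos : ∀ j, 0 < μ (K j))
    (hKL : ∀ j, D.large ⊆ K j ∨ Disjoint D.large (K j)) :
    ∃ S' y, Blocks μ V e x S' y ∧ ∀ j, 0 < μ (K j ∩ S') := by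
  rcases hatoms with ⟨A₁, hA₁, A₂, hA₂, hne⟩ | hempty
  swap
  · exact hb.exists_meeting_of_atomless hV (fun B => D.atomless B (by simp [hempty]))
      hx hx0 hxi hg hei hepos hfeas hS hK hKpos
  have hL := D.measurableSet_large
  obtain ⟨P, hPdef⟩ : ∃ P, P = D.largeᶜ := ⟨_, rfl⟩
  have hPc : Pᶜ = D.large := by rw [hPdef, compl_compl]
  have hP : MeasurableSet P := hPdef ▸ hL.compl
  have hat : ∀ B ⊆ P, ¬ IsMeasureAtom μ B := fun B hB => D.atomless B (by rwa [hPdef] at hB)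
  have hsub : ∀ A ∈ D.atoms, A ⊆ Pᶜ := fun A hA => hPc ▸ subset_sUnion_of_mem hA
  rw [← hPc] at hL hsame hquasi hKL
  have hmeet : ∀ A ∈ D.atoms, ∀ j, 0 < μ (K j ∩ P) ∨ 0 < μ (K j ∩ A) := by
    intro A hA j
    rcases hKL j with h | h
    · right
      rw [inter_eq_self_of_subset_right ((hsub A hA).trans h)]
      exact (D.isAtom A hA).2.1
    · left
      rw [inter_eq_self_of_subset_left (disjoint_compl_left_iff_subset.1 h)]
      exact hKpos j
  obtain ⟨t₁, ht₁⟩ := nonempty_of_measure_ne_zero (D.isAtom A₁ hA₁).2.1.ne'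
  replace ht₁ := hsub A₁ hA₁ ht₁
  have hW : ∀ t ∈ Pᶜ, ∀ y, 0 ≤ y → V t y = V t₁ y := fun t ht => (hsame t ht t₁ ht₁).1
  have he₁ : ∀ t ∈ Pᶜ, e t = e t₁ := fun t ht => (hsame t ht t₁ ht₁).2
  set z := ⨍ s in Pᶜ, x s ∂μ with hz
  have hz0 : 0 ≤ z := average_nonneg_of_nonneg hx0 hxi.integrableOn
  have hVm : Measurable fun t => V t₁ (x t) :=
    (IsUtility.const (hV.continuousOn t₁) (hV.strictMonoOn t₁)).measurable_comp hx hx0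
  by_cases hcase : ∀ᵐ t ∂μ.restrict Pᶜ, V t₁ z ≤ V t₁ (x t)
  · have : NeZero (μ.restrict Pᶜ) := ⟨by
      rw [Ne, Measure.restrict_eq_zero]
      exact fun h => (D.isAtom A₁ hA₁).2.1.ne' (measure_mono_null (hsub A₁ hA₁) h)⟩
    have hnull : μ.restrict Pᶜ {t | V t₁ z < V t₁ (x t)} = 0 := by
      by_contra hcon
      exact lt_irrefl _ (lt_apply_average_of_quasiconcaveOn (hV.continuousOn t₁)
        (hV.strictMonoOn t₁) (hquasi t₁ ht₁) hx hx0 hxi.integrableOn hz0 hcase hcon)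
    have heq : ∀ᵐ t ∂μ.restrict Pᶜ, V t (x t) = V t₁ z := by
      filter_upwards [hcase, measure_eq_zero_iff_ae_notMem.1 hnull, ae_restrict_mem hL]
        with t h1 h2 h3
      rw [hW t h3 _ (hx0 t)]
      exact (not_lt.1 h2).antisymm h1
    have hlt : μ.real A₁ < μ.real Pᶜ := by
      have h12 : Disjoint A₁ A₂ := D.disjoint hA₁ hA₂ hne
      have h1 : μ.real (A₁ ∪ A₂) = μ.real A₁ + μ.real A₂ :=
        measureReal_union h12 (D.isAtom A₂ hA₂).1
      have h2 : μ.real (A₁ ∪ A₂) ≤ μ.real Pᶜ :=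
        measureReal_mono (union_subset (hsub A₁ hA₁) (hsub A₂ hA₂))
      have h3 : 0 < μ.real A₂ :=
        ENNReal.toReal_pos (D.isAtom A₂ hA₂).2.1.ne' (measure_ne_top _ _)
      linarith
    exact hb.exists_meeting_of_eq_average hV hP hat (D.isAtom A₁ hA₁).1 (hsub A₁ hA₁)
      (D.isAtom A₁ hA₁).2.1.ne' hlt hW (hV.continuousOn t₁) (hquasi t₁ ht₁) he₁ hx hx0 hxi hg hei
      hepos hfeas hS heq hK (hmeet A₁ hA₁)
  · set N : Set T := {t | V t₁ (x t) < V t₁ z}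
    have hN : MeasurableSet N := measurableSet_lt hVm measurable_const
    obtain ⟨A, hA, hAN⟩ : ∃ A ∈ D.atoms, μ (A ∩ N) ≠ 0 := by
      by_contra hcon
      push Not at hcon
      refine hcase ?_
      have h0 : μ (N ∩ Pᶜ) = 0 := by
        have : N ∩ Pᶜ = ⋃ A ∈ D.atoms, A ∩ N := by
          rw [hPc, AtomDecomposition.large, sUnion_eq_biUnion, inter_comm, iUnion₂_inter]
        rw [this, measure_biUnion_null_iff D.countable]
        exact hcon
      have h1 : μ.restrict Pᶜ N = 0 := by rwa [Measure.restrict_apply hN]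
      filter_upwards [measure_eq_zero_iff_ae_notMem.1 h1] with t ht
      exact not_lt.1 ht
    obtain ⟨hAm, hApos, hAsplit⟩ := D.isAtom A hA
    -- An atom that meets `N` non-negligibly lies almost entirely in `N`.
    have hdiff : μ (A \ (A ∩ N)) = 0 :=
      (hAsplit (A ∩ N) (hAm.inter hN) inter_subset_left).resolve_left hAN
    refine hV.exists_blocks_of_lt_average hP hat hAm (hsub A hA) hApos.ne' hW he₁ hx hx0 hxi hei
      hepos hfeas ?_ hK (hmeet A hA)
    rw [ae_restrict_iff' hAm]
    filter_upwards [measure_eq_zero_iff_ae_notMem.1 hdiff] with t ht htA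
    rw [hW t (hsub A hA htA) _ (hx0 t)]
    by_contra hcon
    exact ht ⟨htA, fun h => hcon h.2⟩

end LargeAgents

/-! ### Measurability with respect to a partition. -/

section Information

variable {Ω : Type*}

/-- The unions of classes form a σ-algebra containing the generators. -/
theorem mem_iff_mem_of_measurableSet_infoAlgebra {r : Setoid Ω} {B : Set Ω}
    (hB : MeasurableSet[infoAlgebra r] B) {ω ω' : Ω} (h : r ω ω') : ω ∈ B ↔ ω' ∈ B := by
  induction B, hB using MeasurableSpace.generateFrom_induction with
  | hC B hB _ =>
    obtain ⟨y, rfl⟩ := hB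
    exact ⟨fun h' => r.trans (r.symm h) h', fun h' => r.trans h h'⟩
  | empty => simp
  | compl B _ ih => simp [ih]
  | iUnion B _ ih => simp [ih]

theorem eq_of_measurable_infoAlgebra {r : Setoid Ω} {β : Type*} [MeasurableSpace β]
    [MeasurableSingletonClass β] {u : Ω → β} (hu : Measurable[infoAlgebra r] u) {ω ω' : Ω}
    (h : r ω ω') : u ω = u ω' :=
  (mem_iff_mem_of_measurableSet_infoAlgebra (hu (measurableSet_singleton (u ω'))) h).2 rfl

theorem isCondExp_iff_of_measurable {G mΩ : MeasurableSpace Ω} {P : Measure Ω} {u v : Ω → ℝ}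
    (hu : Measurable[G] u) : IsCondExp G P u v ↔ v = u := by
  simp [IsCondExp, hu]

theorem condExpLT_iff_of_measurable {G mΩ : MeasurableSpace Ω} {P : Measure Ω} {u w : Ω → ℝ}
    (hu : Measurable[G] u) (hw : Measurable[G] w) (ω : Ω) :
    CondExpLT G P u w ω ↔ u ω < w ω := by
  simp [CondExpLT, isCondExp_iff_of_measurable hu, isCondExp_iff_of_measurable hw]

end Information

/-! ### From blocking at one state to fine blocking. -/

namespace Economy

variable {Ω T : Type*} [mΩ : MeasurableSpace Ω] [MeasurableSpace T] {ℓ n : ℕ}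

theorem isUtility_agents {E : Economy Ω T ℓ} (hA2 : E.A2) (hA3 : E.A3) (ω : Ω) :
    IsUtility fun t => E.U t ω :=
  ⟨fun x hx => (hA2 x hx).comp measurable_prodMk_right, fun t => (hA3 t ω).1,
    fun t => (hA3 t ω).2⟩

theorem isUtility_states {E : Economy Ω T ℓ} (hA2 : E.A2) (hA3 : E.A3) (t : T) :
    IsUtility fun ω => E.U t ω :=
  ⟨fun x hx => (hA2 x hx).comp measurable_prodMk_left, fun ω => (hA3 t ω).1,
    fun ω => (hA3 t ω).2⟩

theorem isCommunicationSystem_const {E : Economy Ω T ℓ} {Q : Fin n → Setoid Ω} {S : Set T}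
    (hS : MeasurableSet S) (hQ : infoAlgebra (⨅ i, Q i) = mΩ)
    (hmeet : ∀ i, 0 < E.μ ({t | E.part t = Q i} ∩ S)) :
    E.IsCommunicationSystem Q S fun _ => mΩ := by
  refine ⟨⟨fun _ _ => le_rfl, fun G _ => ?_⟩, .of_forall fun t => ⟨?_, ?_⟩⟩
  · by_cases h : mΩ = G
    · simpa [h] using hS
    · simp [h]
  · exact MeasurableSpace.generateFrom_le (E.measurableSet_part t)
  · have : E.partIndices Q S = univ := eq_univ_of_forall fun i => by
      rw [partIndices, mem_ofPred_eq]
      convert hmeet i using 2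
      ext t
      exact and_comm
    rw [pooledInfo, this]
    simp only [mem_univ, iInf_pos]
    exact hQ.ge

/-- A coalition that has all the information between its members and improves upon `f` at some
state fine blocks `f`. -/
theorem fineBlocked_of_blocks {E : Economy Ω T ℓ} {Q : Fin n → Setoid Ω} {f : T → Ω → Fin ℓ → ℝ}
    (hA1 : E.A1') (hA2 : E.A2) (hA3 : E.A3) (hQ : infoAlgebra (⨅ i, Q i) = mΩ)
    (hf : E.IsAssignment f) {ω₀ : Ω} {S : Set T} {y : T → Fin ℓ → ℝ}
    (hb : Blocks E.μ (fun t => E.U t ω₀) (fun t => E.a t ω₀) (fun t => f t ω₀) S y)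
    (hmeet : ∀ i, 0 < E.μ ({t | E.part t = Q i} ∩ S)) : E.FineBlocked Q f S := by
  classical
  obtain ⟨ham, hai, -⟩ := hA1
  have hat : ∀ t, Measurable (E.a t) := fun t => ham.comp measurable_prodMk_left
  have hS := hb.measurableSet
  set r : Setoid Ω := ⨅ i, Q i
  set Ω₀ : Set Ω := {ω | r ω ω₀}
  have hΩ₀ : MeasurableSet Ω₀ := by
    rw [← hQ]
    exact MeasurableSpace.measurableSet_generateFrom (r.mem_classes ω₀)
  have hconst : ∀ {β : Type} [MeasurableSpace β] [MeasurableSingletonClass β] {u : Ω → β},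
      Measurable u → ∀ ω ∈ Ω₀, u ω = u ω₀ := by
    intro β _ _ u hu ω hω
    rw [← hQ] at hu
    exact eq_of_measurable_infoAlgebra hu hω
  -- Endowments elsewhere make `g` feasible in every state, as fine blocking demands an allocation.
  let g : T → Ω → Fin ℓ → ℝ := fun t ω => if ω ∈ Ω₀ ∧ t ∈ S then y t else E.a t ω
  have hg0 : ∀ t ω, 0 ≤ g t ω := fun t ω => by
    by_cases h : ω ∈ Ω₀ ∧ t ∈ S
    · simp only [g, h, and_self, if_true, hb.nonneg t]
    · simp only [g, h, if_false, E.a_nonneg t ω]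
  have hgm : ∀ t, Measurable (g t) := fun t => by
    by_cases h : t ∈ S
    · simp only [g, h, and_true]
      exact Measurable.ite hΩ₀ measurable_const (hat t)
    · simp only [g, h, and_false, if_false]
      exact hat t
  have hgin : ∀ ω ∈ Ω₀, (fun t => g t ω) = S.piecewise y fun t => E.a t ω := fun ω hω => by
    ext t : 1
    by_cases h : t ∈ S <;> simp [g, h, hω]
  have hgout : ∀ ω ∉ Ω₀, (fun t => g t ω) = fun t => E.a t ω := fun ω hω => by
    ext t : 1
    simp [g, hω]
  have hgi : ∀ ω, Integrable (fun t => g t ω) E.μ := fun ω => by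
    by_cases hω : ω ∈ Ω₀
    · rw [hgin ω hω]
      exact Integrable.piecewise hS hb.integrable.integrableOn (hai ω).integrableOn
    · rw [hgout ω hω]
      exact hai ω
  have hgS : ∀ ω ∈ Ω₀, ∫ t in S, g t ω ∂E.μ = ∫ t in S, E.a t ω ∂E.μ := fun ω hω => by
    have h1 : ∫ t in S, g t ω ∂E.μ = ∫ t in S, y t ∂E.μ :=
      setIntegral_congr_fun hS fun t ht => by simp [g, ht, hω]
    rw [h1, hb.integral_eq]
    exact setIntegral_congr_fun hS fun t _ => (hconst (hat t) ω hω).symm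
  refine ⟨g, fun _ => mΩ, Ω₀, ⟨⟨hg0, hgi, hgm⟩, fun ω => ?_⟩,
    isCommunicationSystem_const hS hQ hmeet, ⟨ω₀, r.refl ω₀⟩, fun _ _ => hΩ₀,
    fun ω hω => ⟨hgS ω hω, ?_⟩⟩
  · by_cases hω : ω ∈ Ω₀
    · rw [← integral_add_compl hS (hgi ω), ← integral_add_compl hS (hai ω), hgS ω hω]
      congr 1
      exact setIntegral_congr_fun hS.compl fun t ht => by
        have : t ∉ S := ht
        simp [g, this]
    · rw [hgout ω hω]
  · filter_upwards [hb.lt, ae_restrict_mem hS] with t ht htS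
    have hU := isUtility_states hA2 hA3 t
    rw [condExpLT_iff_of_measurable (hU.measurable_comp (hf.2.2 t) (hf.1 t))
      (hU.measurable_comp (hgm t) (hg0 t))]
    have hgy : g t ω = y t := by simp [g, hω, htS]
    rw [hgy, hconst (hf.2.2 t) ω hω, hconst (hU.measurable _ (hf.1 t ω₀)) ω hω,
      hconst (hU.measurable _ (hb.nonneg t)) ω hω]
    exact ht

end Economy

end MixedEconomy

end

theorem theorem4p2 {Ω T : Type*} [MeasurableSpace Ω] [MeasurableSpace T] {ℓ n : ℕ}
    (E : MixedEconomy.Economy Ω T ℓ) (D : MixedEconomy.AtomDecomposition E.μ)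
    (Q : Fin n → Setoid Ω)
    (hA1 : E.A1') (hA2 : E.A2) (hA3 : E.A3) (hA4 : E.A4' D) (hA5 : E.A5 Q) (hA6 : E.A6 D)
    (hatoms : D.atoms.Nontrivial ∨ D.atoms = ∅) :
    E.fineCore Q ⊆ E.exPostCore := by
  rintro f ⟨hf, hfine⟩
  refine ⟨hf, ?_⟩
  rintro S ⟨hSm, hS⟩ ⟨ω₀, g, hg, hgS, hlt⟩
  have := E.μ_finite
  -- Completeness upgrades the a.e. measurability of integrable sections to measurability.
  have := E.μ_complete
  obtain ⟨hQm, hQcover, hQ⟩ := hA5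
  have hne : (ae (E.μ.restrict S)).NeBot := by
    rw [ae_neBot]
    simpa using hS.ne'
  obtain ⟨t₀, ht₀⟩ := hlt.exists
  -- Without commodities there is a single bundle and no strict improvement.
  have hℓ : Nonempty (Fin ℓ) := by
    by_contra hcon
    have : IsEmpty (Fin ℓ) := not_nonempty_iff.1 hcon
    rw [Subsingleton.elim (f t₀ ω₀) (g t₀ ω₀)] at ht₀
    exact lt_irrefl _ ht₀
  have hb : MixedEconomy.Blocks E.μ (fun t => E.U t ω₀) (fun t => E.a t ω₀) (fun t => f t ω₀) S
      (fun t => g t ω₀) := ⟨hSm, fun t => hg.1 t ω₀, hg.2.1 ω₀, hgS, hlt⟩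
  obtain ⟨S', y, hb', hmeet⟩ := hb.exists_meeting
    (MixedEconomy.Economy.isUtility_agents hA2 hA3 ω₀) D
    (fun t ht s hs => ⟨(hA6 t ht s hs).2.1 ω₀, congrFun (hA6 t ht s hs).2.2.1 ω₀⟩)
    (fun t ht => hA4 t ht ω₀) hatoms (aemeasurable_iff_measurable.1 (hf.1.2.1 ω₀).aemeasurable)
    (fun t => hf.1.1 t ω₀) (hf.1.2.1 ω₀) (aemeasurable_iff_measurable.1 (hg.2.1 ω₀).aemeasurable)
    (hA1.2.1 ω₀) (hA1.2.2 ω₀) (hf.2 ω₀) hS.ne' (K := fun i => {t | E.part t = Q i})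
    (fun i => (hQm i).1) (fun i => (hQm i).2) (fun i => by
      by_cases h : ∃ t ∈ D.large, E.part t = Q i
      · obtain ⟨t, ht, hti⟩ := h
        exact .inl fun s hs => (hA6 s hs t ht).1.trans hti
      · exact .inr (disjoint_left.2 fun t ht hti => h ⟨t, ht, hti⟩))
  obtain ⟨i, -⟩ := hQcover t₀
  exact hfine S' ⟨hb'.measurableSet, (hmeet i).trans_le (measure_mono inter_subset_right)⟩
    (MixedEconomy.Economy.fineBlocked_of_blocks hA1 hA2 hA3 hQ hf.1 hb' hmeet)
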